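/- Let $\mathbb K\in\{\mathbb R,\mathbb C\}$. For $0<s\le 2$ let $\mu_s$ be the rotation invariant $s$-stable probability measure on $\mathbb K$, i.e. the probability measure with $\int_{\mathbb K} e^{i\,\mathrm{Re}(z\bar t)}\,d\mu_s(z)=e^{-\sigma|t|^s}$ for all $t\in\mathbb K$, where $\sigma>0$ is an arbitrary fixed normalization constant (for $s=2$ this is a centred Gaussian measure); let $\mu_s^N$ be the $N$-fold product of $\mu_s$ on $\mathbb K^N$, and put $c_{s,p}=\left(\int_{\mathbb K}|z|^p\,d\mu_s(z)\right)^{1/p}$. For $1\le r\le\infty$ let $\ell_r^N$ be $\mathbb K^N$ with the $r$-norm and let $r'$ be the conjugate exponent, $\frac1r+\frac1{r'}=1$. For normed spaces $E_1,\dots,E_m,F$ and $0<p<\infty$, a continuous $m$-linear map $T:E_1\times\dots\times E_m\to F$ is multiple $p$-summing if there is $C>0$ such that for all finite sequences $(x^i_{j})_{j=1}^{J_i}\subset E_i$, $i=1,\dots,m$, $$\Big(\sum_{j_1,\dots,j_m}\|T(x^1_{j_1},\dots,x^m_{j_m})\|_F^p\Big)^{1/p}\le C\prod_{i=1}^m w_p\big((x^i_j)_j\big),\qquad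 w_p\big((y_j)_j\big)=\sup_{\gamma\in B_{E'}}\Big(\sum_j|\gamma(y_j)|^p\Big)^{1/p},$$ where $(y_j)_j$ is a finite sequence in a normed space $E$ and $B_{E'}$ is the closed unit ball of its dual. The infimum of all such $C$ is denoted by $\pi_p(T)$. For $1\le q\le\infty$, a normed space $X$ over $\mathbb K$ is an $\mathcal L^g_{q,1}$-space if for every finite dimensional subspace $M\subset X$ and every $\varepsilon>0$ there are $n\in\mathbb N$ and continuous linear maps $R:M\to\ell_q^n$, $S:\ell_q^n\to X$ with $S(R(x))=x$ for all $x\in M$ and $\|S\|\,\|R\|\le 1+\varepsilon$. **Theorem.** Let $1\le q,r\le\infty$ and $0<p<\infty$, let $X$ be an $\mathcal L^g_{q,1}$-space over $\mathbb K$ and let $T:\ell_r^N\times\dots\times\ell_r^N\to X$ be $m$-linear. Suppose that one of the following conditions holds: - (a) $r=q=2$; - (b) $r=2$ and either $p<q<2$ or $p=q$; - (c) $p<r'<2$ and either $p<q\le 2$ or $p=q$. Then $T$ is multiple $p$-summing, the function $(z^{(1)},\dots,z^{(m)})\mapsto\|T(z^{(1)},\dots,z^{(m)})\|_X^p$ is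 integrable with respect to the product measure $\mu_{r'}^N\times\dots\times\mu_{r'}^N$, and $$\pi_p(T)=\frac1{c_{r',p}^m}\left(\int_{\mathbb K^N}\cdots\int_{\mathbb K^N}\|T(z^{(1)},\dots,z^{(m)})\|_X^p\,d\mu_{r'}^N(z^{(1)})\cdots d\mu_{r'}^N(z^{(m)})\right)^{1/p}.$$ -/

import Mathlib

open MeasureTheory ProbabilityTheory Filter
open scoped ENNReal NNReal Topology

theorem integrableOn_stableProfile {s : ℝ} (hs : 0 < s) (hs2 : s < 2) :
    IntegrableOn (fun u : ℝ => (1 - Real.exp (-u ^ 2 / 2)) * (s * u ^ (-(s + 1))))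
      (Set.Ioi 0) := by
  have hm : Measurable (fun u : ℝ => (1 - Real.exp (-u ^ 2 / 2)) * (s * u ^ (-(s + 1)))) := by
    fun_prop
  rw [← Set.Ioc_union_Ioi_eq_Ioi (zero_le_one' ℝ)]
  refine IntegrableOn.union ?_ ?_
  · have h1 : IntegrableOn (fun u : ℝ => s * u ^ (1 - s)) (Set.Ioc 0 1) := by
      have := (intervalIntegral.intervalIntegrable_rpow' (a := 0) (b := 1)
        (r := 1 - s) (by linarith)).const_mul s
      rwa [intervalIntegrable_iff_integrableOn_Ioc_of_le zero_le_one] at this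
    refine Integrable.mono' h1 hm.aestronglyMeasurable ?_
    refine (ae_restrict_iff' measurableSet_Ioc).2 (ae_of_all _ fun u hu => ?_)
    have hu0 : 0 < u := hu.1
    have e1 : 1 - Real.exp (-u ^ 2 / 2) ≤ u ^ 2 := by
      have := Real.add_one_le_exp (-u ^ 2 / 2)
      nlinarith [sq_nonneg u]
    have e2 : 0 ≤ 1 - Real.exp (-u ^ 2 / 2) := by
      have : Real.exp (-u ^ 2 / 2) ≤ 1 := Real.exp_le_one_iff.2 (by nlinarith [sq_nonneg u])
      linarith
    have e3 : 0 ≤ s * u ^ (-(s + 1)) := by positivity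
    rw [Real.norm_of_nonneg (mul_nonneg e2 e3)]
    calc _ ≤ u ^ 2 * (s * u ^ (-(s + 1))) := by gcongr
      _ = s * (u ^ (2 : ℝ) * u ^ (-(s + 1))) := by norm_cast; ring
      _ = s * u ^ (1 - s) := by rw [← Real.rpow_add hu0]; ring_nf
  · have h1 : IntegrableOn (fun u : ℝ => s * u ^ (-(s + 1))) (Set.Ioi 1) :=
      (integrableOn_Ioi_rpow_of_lt (by linarith) zero_lt_one).const_mul s
    refine Integrable.mono' h1 hm.aestronglyMeasurable ?_
    refine (ae_restrict_iff' measurableSet_Ioi).2 (ae_of_all _ fun u hu => ?_)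
    have hu0 : 0 < u := zero_lt_one.trans hu
    have e2 : 0 ≤ 1 - Real.exp (-u ^ 2 / 2) := by
      have : Real.exp (-u ^ 2 / 2) ≤ 1 := Real.exp_le_one_iff.2 (by nlinarith [sq_nonneg u])
      linarith
    have e4 : 1 - Real.exp (-u ^ 2 / 2) ≤ 1 := by linarith [Real.exp_pos (-u ^ 2 / 2)]
    have e3 : 0 ≤ s * u ^ (-(s + 1)) := by positivity
    rw [Real.norm_of_nonneg (mul_nonneg e2 e3)]
    exact mul_le_of_le_one_left e3 e4

theorem integral_paretoMeasure_one {s : ℝ} (hs : 0 < s) (f : ℝ → ℝ) :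
    ∫ a, f a ∂(paretoMeasure 1 s) = ∫ a in Set.Ioi 1, f a * (s * a ^ (-(s + 1))) := by
  rw [paretoMeasure]
  have h0 : (paretoPDF 1 s) = fun x => ENNReal.ofReal (paretoPDFReal 1 s x) := rfl
  rw [h0, integral_withDensity_eq_integral_toReal_smul (by fun_prop) (by simp)]
  rw [← integral_Ici_eq_integral_Ioi, ← integral_indicator measurableSet_Ici]
  congr 1
  ext x
  by_cases hx : 1 ≤ x
  · have : 0 < x := by linarith
    rw [Set.indicator_of_mem (Set.mem_Ici.2 hx), ENNReal.toReal_ofReal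
      (paretoPDFReal_nonneg zero_le_one hs.le _), paretoPDFReal, if_pos hx]
    simp; ring
  · rw [Set.indicator_of_notMem (by simpa using hx), paretoPDFReal, if_neg hx]
    simp

/-- Characteristic function at radius `τ` of a Gaussian vector with Pareto distributed scale. -/
theorem one_sub_integral_pareto {s : ℝ} (hs : 0 < s) {τ : ℝ} (hτ : 0 < τ) :
    1 - ∫ a, Real.exp (-(a * τ) ^ 2 / 2) ∂(paretoMeasure 1 s) =
      τ ^ s * ∫ u in Set.Ioi τ, (1 - Real.exp (-u ^ 2 / 2)) * (s * u ^ (-(s + 1))) := by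
  have := isProbabilityMeasure_paretoMeasure zero_lt_one hs
  have h1 : 1 - ∫ a, Real.exp (-(a * τ) ^ 2 / 2) ∂(paretoMeasure 1 s) =
      ∫ a, (1 - Real.exp (-(a * τ) ^ 2 / 2)) ∂(paretoMeasure 1 s) := by
    rw [integral_sub (integrable_const _)]
    · simp
    · refine Integrable.of_bound (C := 1) (by fun_prop) (ae_of_all _ fun a => ?_)
      rw [Real.norm_of_nonneg (Real.exp_pos _).le]
      exact Real.exp_le_one_iff.2 (by nlinarith [sq_nonneg (a * τ)])
  rw [h1, integral_paretoMeasure_one hs]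
  have h2 := integral_comp_mul_left_Ioi
    (fun u => (1 - Real.exp (-u ^ 2 / 2)) * (s * u ^ (-(s + 1)))) 1 hτ
  rw [mul_one, smul_eq_mul] at h2
  have h3 : ∫ u in Set.Ioi τ, (1 - Real.exp (-u ^ 2 / 2)) * (s * u ^ (-(s + 1))) =
      τ * ∫ x in Set.Ioi 1, (1 - Real.exp (-(τ * x) ^ 2 / 2)) * (s * (τ * x) ^ (-(s + 1))) := by
    rw [h2, mul_inv_cancel_left₀ hτ.ne']
  rw [h3, ← integral_const_mul, ← integral_const_mul]
  refine setIntegral_congr_fun measurableSet_Ioi fun x hx => ?_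
  have hx0 : (0 : ℝ) < x := zero_lt_one.trans hx
  have e : τ ^ s * τ * τ ^ (-(s + 1)) = 1 := by
    rw [← Real.rpow_add_one hτ.ne', ← Real.rpow_add hτ]; simp
  simp only [Real.mul_rpow hτ.le hx0.le, mul_comm x τ]
  calc _ = (τ ^ s * τ * τ ^ (-(s + 1))) *
        ((1 - Real.exp (-(τ * x) ^ 2 / 2)) * (s * x ^ (-(s + 1)))) := by rw [e, one_mul]
    _ = _ := by ring

section Existence

variable {E : Type*} [NormedAddCommGroup E] [InnerProductSpace ℝ E] [FiniteDimensional ℝ E]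
  [MeasurableSpace E] [BorelSpace E]

theorem exists_of_tendsto_charFun (μ : ℕ → Measure E) [∀ n, IsProbabilityMeasure (μ n)]
    (f : E → ℂ) (hf : ContinuousAt f 0)
    (h : ∀ t, Tendsto (fun n => charFun (μ n) t) atTop (𝓝 (f t))) :
    ∃ ν : Measure E, IsProbabilityMeasure ν ∧ ∀ t, charFun ν t = f t := by
  have ht := isTightMeasureSet_of_tendsto_charFun hf h
  let P : ℕ → ProbabilityMeasure E := fun n => ⟨μ n, inferInstance⟩
  have hc : IsCompact (closure (Set.range P)) := by
    apply isCompact_closure_of_isTightMeasureSet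
    convert ht using 1
    ext ν
    constructor
    · rintro ⟨_, ⟨n, rfl⟩, rfl⟩
      exact ⟨n, rfl⟩
    · rintro ⟨n, rfl⟩
      exact ⟨P n, ⟨n, rfl⟩, rfl⟩
  obtain ⟨ν, -, hν⟩ := hc.ultrafilter_le_nhds ((hyperfilter ℕ).map P)
    (by
      rw [le_principal_iff]
      exact mem_of_superset (mem_map.2 (univ_mem' fun n => Set.mem_range_self n)) subset_closure)
  refine ⟨ν, inferInstance, fun t => ?_⟩
  have hT : Tendsto P (hyperfilter ℕ) (𝓝 ν) := hν
  rw [ProbabilityMeasure.tendsto_iff_forall_integral_rclike_tendsto ℂ] at hT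
  have h1 := hT (BoundedContinuousFunction.innerProbChar t)
  have h2 := (h t).mono_left (Nat.hyperfilter_le_atTop)
  simp_rw [charFun_eq_integral_innerProbChar] at h2 ⊢
  exact tendsto_nhds_unique h1 h2

theorem exists_charFun_pareto {s : ℝ} (hs : 0 < s) :
    ∃ ν : Measure E, IsProbabilityMeasure ν ∧ ∀ t : E,
      charFun ν t = ((∫ a, Real.exp (-(a * ‖t‖) ^ 2 / 2) ∂(paretoMeasure 1 s) : ℝ) : ℂ) := by
  have := isProbabilityMeasure_paretoMeasure zero_lt_one hs
  have hm : Measurable (fun x : ℝ × E => x.1 • x.2) := by fun_prop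
  refine ⟨((paretoMeasure 1 s).prod (stdGaussian E)).map (fun x => x.1 • x.2),
    Measure.isProbabilityMeasure_map hm.aemeasurable, fun t => ?_⟩
  rw [charFun_apply, integral_map hm.aemeasurable (by fun_prop), integral_prod]
  · rw [← integral_complex_ofReal]
    congr 1
    ext a
    have : ∫ y : E, Complex.exp ((inner ℝ (a • y) t : ℝ) * Complex.I) ∂(stdGaussian E) =
        charFun (stdGaussian E) (a • t) := by
      rw [charFun_apply]
      simp_rw [real_inner_smul_left, real_inner_smul_right]
    simp only [this, charFun_stdGaussian, norm_smul]
    push_cast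
    rw [mul_pow, mul_pow, ← Complex.ofReal_pow, ← Complex.ofReal_pow]
    simp
  · refine Integrable.of_bound (C := 1) (by fun_prop) (ae_of_all _ fun a => ?_)
    rw [Complex.norm_exp_ofReal_mul_I]

theorem exists_stableMeasure {s σ : ℝ} (hs : 0 < s) (hs2 : s ≤ 2) (hσ : 0 < σ) :
    ∃ μ : Measure E, IsProbabilityMeasure μ ∧
      ∀ t : E, charFun μ t = ((Real.exp (-(σ * ‖t‖ ^ s)) : ℝ) : ℂ) := by
  -- by scaling, one value of the scale parameter suffices
  suffices H : ∃ K : ℝ, 0 < K ∧ ∃ μ : Measure E, IsProbabilityMeasure μ ∧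
      ∀ t : E, charFun μ t = ((Real.exp (-(K * ‖t‖ ^ s)) : ℝ) : ℂ) by
    obtain ⟨K, hK, μ, hμ, h⟩ := H
    have hm : Measurable (fun x : E => ((σ / K) ^ s⁻¹) • x) := by fun_prop
    refine ⟨μ.map (fun x => ((σ / K) ^ s⁻¹) • x),
      Measure.isProbabilityMeasure_map hm.aemeasurable, fun t => ?_⟩
    have hp : (0 : ℝ) < σ / K := by positivity
    rw [charFun_map_smul, h, norm_smul, Real.norm_of_nonneg (by positivity),
      Real.mul_rpow (by positivity) (by positivity), Real.rpow_inv_rpow hp.le hs.ne']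
    rw [← mul_assoc, mul_div_cancel₀ _ hK.ne']
  rcases hs2.eq_or_lt with rfl | hs2
  · refine ⟨1 / 2, by norm_num, stdGaussian E, inferInstance, fun t => ?_⟩
    rw [charFun_stdGaussian]
    push_cast
    norm_cast
    push_cast
    ring_nf
  set g : ℝ → ℝ := fun u => (1 - Real.exp (-u ^ 2 / 2)) * (s * u ^ (-(s + 1))) with hg
  have hgi : IntegrableOn g (Set.Ioi 0) := integrableOn_stableProfile hs hs2
  have hgp : ∀ u ∈ Set.Ioi (0 : ℝ), 0 < g u := fun u hu => by
    have hu : 0 < u := hu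
    have : Real.exp (-u ^ 2 / 2) < 1 := Real.exp_lt_one_iff.2 (by nlinarith [sq_pos_of_pos hu])
    have : 0 < 1 - Real.exp (-u ^ 2 / 2) := by linarith
    simp only [hg]; positivity
  have hK : 0 < ∫ u in Set.Ioi 0, g u := by
    rw [setIntegral_pos_iff_support_of_nonneg_ae
      ((ae_restrict_iff' measurableSet_Ioi).2 (ae_of_all _ fun u hu => (hgp u hu).le)) hgi]
    have : Function.support g ∩ Set.Ioi 0 = Set.Ioi 0 :=
      Set.inter_eq_right.2 fun u hu => (hgp u hu).ne'
    simp [this]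
  refine ⟨_, hK, ?_⟩
  obtain ⟨ν, hν, hc⟩ := exists_charFun_pareto (E := E) hs
  let μ : ℕ → Measure E := fun n =>
    ((Measure.pi fun _ : Fin n => ν).map (fun x => ∑ i, x i)).map
      (fun x => ((n : ℝ) ^ (-s⁻¹)) • x)
  have hμ : ∀ n, IsProbabilityMeasure (μ n) := fun n => by
    have h1 : Measurable (fun x : Fin n → E => ∑ i, x i) := by fun_prop
    have h2 : Measurable (fun x : E => ((n : ℝ) ^ (-s⁻¹)) • x) := by fun_prop
    have := Measure.isProbabilityMeasure_map (μ := Measure.pi fun _ : Fin n => ν) h1.aemeasurable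
    exact Measure.isProbabilityMeasure_map h2.aemeasurable
  refine exists_of_tendsto_charFun μ _ ?_ fun t => ?_
  · refine Continuous.continuousAt ?_
    refine Complex.continuous_ofReal.comp (Real.continuous_exp.comp ?_)
    exact (continuous_const.mul (continuous_norm.rpow_const fun _ => Or.inr hs.le)).neg
  have hn : ∀ n : ℕ, charFun (μ n) t =
      (((∫ a, Real.exp (-(a * ((n : ℝ) ^ (-s⁻¹) * ‖t‖)) ^ 2 / 2) ∂(paretoMeasure 1 s)) ^ n : ℝ)
        : ℂ) := fun n => by
    simp only [μ]
    rw [charFun_map_smul, charFun_map_sum_pi_eq_prod]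
    simp [hc, norm_smul, abs_of_nonneg (Real.rpow_nonneg (Nat.cast_nonneg n) (-s⁻¹))]
  simp_rw [hn]
  refine (Complex.continuous_ofReal.tendsto _).comp ?_
  rcases eq_or_ne t 0 with rfl | ht
  · have := isProbabilityMeasure_paretoMeasure zero_lt_one hs
    simp [Real.zero_rpow hs.ne']
  have ht : 0 < ‖t‖ := norm_pos_iff.2 ht
  set w : ℕ → ℝ := fun n =>
    ∫ a, Real.exp (-(a * ((n : ℝ) ^ (-s⁻¹) * ‖t‖)) ^ 2 / 2) ∂(paretoMeasure 1 s) with hw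
  have hτ : Tendsto (fun n : ℕ => (n : ℝ) ^ (-s⁻¹) * ‖t‖) atTop (𝓝 0) := by
    have := ((tendsto_rpow_neg_atTop (inv_pos.2 hs)).comp
      tendsto_natCast_atTop_atTop).mul_const ‖t‖
    simpa using this
  have hkey : Tendsto (fun n : ℕ => (n : ℝ) * (w n - 1)) atTop
      (𝓝 (-((∫ u in Set.Ioi 0, g u) * ‖t‖ ^ s))) := by
    have hlim : Tendsto (fun n : ℕ => ∫ u in Set.Ioi ((n : ℝ) ^ (-s⁻¹) * ‖t‖), g u) atTop
        (𝓝 (∫ u in Set.Ioi 0, g u)) := by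
      have e : ∀ n : ℕ, ∫ u in Set.Ioi ((n : ℝ) ^ (-s⁻¹) * ‖t‖), g u =
          ∫ u in Set.Ioi 0, (Set.Ioi ((n : ℝ) ^ (-s⁻¹) * ‖t‖)).indicator g u := fun n => by
        rw [setIntegral_indicator measurableSet_Ioi, Set.inter_eq_right.2]
        exact Set.Ioi_subset_Ioi (by positivity)
      simp_rw [e]
      refine tendsto_integral_of_dominated_convergence (fun u => ‖g u‖)
        (fun n => (hgi.1.indicator measurableSet_Ioi)) hgi.norm
        (fun n => ae_of_all _ fun u => norm_indicator_le_norm_self g u) ?_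
      refine (ae_restrict_iff' measurableSet_Ioi).2 (ae_of_all _ fun u hu => ?_)
      refine tendsto_const_nhds.congr' ?_
      filter_upwards [hτ.eventually_lt_const hu] with n hn
      exact (Set.indicator_of_mem (Set.mem_Ioi.2 hn) g).symm
    have hlim2 := (hlim.mul_const (‖t‖ ^ s)).neg
    refine hlim2.congr' ?_
    filter_upwards [eventually_gt_atTop 0] with n hn
    have hn' : (0 : ℝ) < n := Nat.cast_pos.2 hn
    have h1 := one_sub_integral_pareto hs (τ := (n : ℝ) ^ (-s⁻¹) * ‖t‖) (by positivity)
    have h2 : ((n : ℝ) ^ (-s⁻¹) * ‖t‖) ^ s = (n : ℝ)⁻¹ * ‖t‖ ^ s := by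
      rw [Real.mul_rpow (by positivity) ht.le, ← Real.rpow_mul hn'.le]
      simp [hs.ne', Real.rpow_neg_one]
    have h3 : w n - 1 = -((n : ℝ)⁻¹ * ‖t‖ ^ s *
        ∫ u in Set.Ioi ((n : ℝ) ^ (-s⁻¹) * ‖t‖), g u) := by
      rw [← h2, ← h1]; ring
    rw [h3]
    field_simp
  have := Real.tendsto_one_add_pow_exp_of_tendsto hkey
  simpa using this
end Existence

noncomputable section

/-- The rotation invariant `s`-stable Lévy measure on the scalar field `𝕜` (that is, `ℝ` or `ℂ`):
for `0 < s ≤ 2` it is the unique probability measure whose characteristic function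
`t ↦ ∫ exp (i Re (z * conj t)) dμ(z)` is `t ↦ exp (-σ |t| ^ s)`; for `s = 2` this is a centred
Gaussian measure. The parameter `σ > 0` fixes the normalization. Outside this range of parameters
the value is immaterial (a Dirac mass). -/
def stableMeasure (𝕜 : Type*) [RCLike 𝕜] (s σ : ℝ) : Measure 𝕜 :=
  open Classical in
  if h : 0 < s ∧ s ≤ 2 ∧ 0 < σ then
    (exists_stableMeasure (E := 𝕜) h.1 h.2.1 h.2.2).choose
  else Measure.dirac 0

instance isProbabilityMeasure_stableMeasure (𝕜 : Type*) [RCLike 𝕜] (s σ : ℝ) :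
    IsProbabilityMeasure (stableMeasure 𝕜 s σ) := by
  unfold stableMeasure
  split_ifs with h
  · exact (exists_stableMeasure (E := 𝕜) h.1 h.2.1 h.2.2).choose_spec.1
  · infer_instance

theorem charFun_stableMeasure {𝕜 : Type*} [RCLike 𝕜] {s σ : ℝ} (hs : 0 < s) (hs2 : s ≤ 2)
    (hσ : 0 < σ) (t : 𝕜) :
    charFun (stableMeasure 𝕜 s σ) t = ((Real.exp (-(σ * ‖t‖ ^ s)) : ℝ) : ℂ) := by
  have h : 0 < s ∧ s ≤ 2 ∧ 0 < σ := ⟨hs, hs2, hσ⟩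
  rw [stableMeasure, dif_pos h]
  exact (exists_stableMeasure (E := 𝕜) h.1 h.2.1 h.2.2).choose_spec.2 t

/-- The `s`-stable Lévy measure on `𝕜 ^ N`: the law of `N` independent copies of the
one-dimensional one. -/
def stableMeasurePi (𝕜 : Type*) [RCLike 𝕜] (N : ℕ) (s σ : ℝ) : Measure (Fin N → 𝕜) :=
  Measure.pi fun _ : Fin N => stableMeasure 𝕜 s σ

/-- The constant `c_{s,p}`, the `L_p`-norm of the identity under the one-dimensional `s`-stable
measure. -/
def stableMoment (𝕜 : Type*) [RCLike 𝕜] (s σ p : ℝ) : ℝ :=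
  (∫ z, ‖z‖ ^ p ∂(stableMeasure 𝕜 s σ)) ^ (1 / p)

/-- The weak `ℓ_p`-norm `w_p` of a finite sequence of vectors. -/
def weakLpNorm (𝕜 : Type*) [RCLike 𝕜] {E : Type*} [NormedAddCommGroup E] [NormedSpace 𝕜 E]
    (p : ℝ) {n : ℕ} (y : Fin n → E) : ℝ :=
  sSup {a : ℝ | ∃ γ : E →L[𝕜] 𝕜, ‖γ‖ ≤ 1 ∧ a = (∑ j, ‖γ (y j)‖ ^ p) ^ (1 / p)}

/-- `C` is an admissible constant in the definition of multiple `p`-summing operators. -/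
def IsMultipleSummingConst {𝕜 : Type*} [RCLike 𝕜] {m : ℕ} {E : Fin m → Type*} {F : Type*}
    [∀ i, NormedAddCommGroup (E i)] [∀ i, NormedSpace 𝕜 (E i)]
    [NormedAddCommGroup F] [NormedSpace 𝕜 F] (p : ℝ)
    (T : ContinuousMultilinearMap 𝕜 E F) (C : ℝ) : Prop :=
  ∀ (J : Fin m → ℕ) (x : ∀ i, Fin (J i) → E i),
    (∑ j : ∀ i, Fin (J i), ‖T fun i => x i (j i)‖ ^ p) ^ (1 / p) ≤
      C * ∏ i, weakLpNorm 𝕜 p (x i)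

/-- `T` is multiple `p`-summing. -/
def IsMultipleSumming {𝕜 : Type*} [RCLike 𝕜] {m : ℕ} {E : Fin m → Type*} {F : Type*}
    [∀ i, NormedAddCommGroup (E i)] [∀ i, NormedSpace 𝕜 (E i)]
    [NormedAddCommGroup F] [NormedSpace 𝕜 F] (p : ℝ)
    (T : ContinuousMultilinearMap 𝕜 E F) : Prop :=
  ∃ C : ℝ, 0 < C ∧ IsMultipleSummingConst p T C

/-- The multiple `p`-summing norm `π_p(T)`. -/
def multipleSummingNorm {𝕜 : Type*} [RCLike 𝕜] {m : ℕ} {E : Fin m → Type*} {F : Type*}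
    [∀ i, NormedAddCommGroup (E i)] [∀ i, NormedSpace 𝕜 (E i)]
    [NormedAddCommGroup F] [NormedSpace 𝕜 F] (p : ℝ)
    (T : ContinuousMultilinearMap 𝕜 E F) : ℝ :=
  sInf {C : ℝ | 0 < C ∧ IsMultipleSummingConst p T C}

/-- `X` is an `ℒ^g_{q,lam}`-space: for every finite dimensional subspace `M` and every `ε > 0` the
inclusion of `M` into `X` factors through some `ℓ_q^n` as `S ∘ R` with
`‖S‖ * ‖R‖ ≤ lam + ε`. -/
def IsLgSpace (𝕜 : Type*) [RCLike 𝕜] (q : ℝ≥0∞) [Fact (1 ≤ q)] (lam : ℝ)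
    (X : Type*) [NormedAddCommGroup X] [NormedSpace 𝕜 X] : Prop :=
  ∀ M : Submodule 𝕜 X, FiniteDimensional 𝕜 M → ∀ ε : ℝ, 0 < ε →
    ∃ (n : ℕ) (R : M →L[𝕜] PiLp q (fun _ : Fin n => 𝕜))
      (S : PiLp q (fun _ : Fin n => 𝕜) →L[𝕜] X),
      (∀ x : M, S (R x) = x) ∧ ‖S‖ * ‖R‖ ≤ lam + ε

end

/-! A functional on `ℓ_r^N` has the form `γ z = ∑ a_i z_i` with `‖γ‖` the `r'`-norm of `a`. If the
`z_i` are independent `r'`-stable variables, `γ z` is distributed as `‖γ‖` times a single one, so `∫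
|γ|^p = c ‖γ‖^p` with `c = c_{r',p}^p`: the dual norm is an `L_p`-norm. This needs a finite moment
of order `p`, hence `p < r'` or the Gaussian case `r' = 2`.

Upper bound. For one functional, `∑_j |γ(x_j)|^p ≤ w_p(x)^p ‖γ‖^p = w_p(x)^p c⁻¹ ∫ |γ|^p`. For a
scalar form this is applied in one variable at a time (`sum_enorm_rpow_le_lintegral_of_form`). A
target that embeds isometrically into `L_p` follows by integrating the scalar estimate over the
representing functionals. The space `ℓ_q^n` embeds in this way through `q`-stable variables, or
trivially if `p = q`, and an `ℒ^g_{q,1}`-space looks like `ℓ_q^n` up to a factor `1 + ε` on the span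
of the range of `T`.

Lower bound, valid for every normed target. A random vector taking finitely many values is a finite
sequence once each value is weighted by the `1/p`-th power of its probability; the summing
inequality then compares integrals. Approximating the stable vector by such vectors and using
Fatou's lemma gives `∫ ‖T‖^p ≤ C^p c^m` for each admissible `C`
(`lintegral_le_of_isMultipleSummingConst`). -/

/-! ### Tails and moments -/

/-- A polynomial tail bound of order `s` gives finite moments of every order `p < s`. -/
theorem memLp_of_measureReal_gt_le_rpow {α : Type*} [MeasurableSpace α] {μ : Measure α}
    [IsProbabilityMeasure μ] {f : α → ℝ} (hf : AEStronglyMeasurable f μ) {K s p : ℝ}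
    (hp : 0 < p) (hps : p < s)
    (h : ∀ r : ℝ, 0 < r → μ.real {x | r < |f x|} ≤ K * r ^ (-s)) :
    MemLp f (ENNReal.ofReal p) μ := by
  refine ⟨hf, ?_⟩
  rw [eLpNorm_lt_top_iff_lintegral_rpow_enorm_lt_top (by simpa) (by simp),
    ENNReal.toReal_ofReal hp.le]
  have e : ∀ x, ‖f x‖ₑ ^ p = ENNReal.ofReal (|f x| ^ p) := fun x => by
    rw [← ENNReal.ofReal_rpow_of_nonneg (abs_nonneg _) hp.le, Real.enorm_eq_ofReal_abs]
  simp_rw [e]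
  rw [lintegral_rpow_eq_lintegral_meas_lt_mul μ (ae_of_all _ fun x => abs_nonneg _)
    (by fun_prop) hp]
  refine ENNReal.mul_lt_top (by simp) ?_
  -- Near `0` the probability is at most `1` and `u ^ (p - 1)` is integrable because `p > 0`; beyond
  -- `1` the tail bound leaves `u ^ (p - 1 - s)`, integrable because `p < s`.
  rw [← Set.Ioc_union_Ioi_eq_Ioi (zero_le_one' ℝ)]
  refine (lintegral_union_le _ _ _).trans_lt (ENNReal.add_lt_top.2 ⟨?_, ?_⟩)
  · have h1 : IntegrableOn (fun u : ℝ => u ^ (p - 1)) (Set.Ioc 0 1) := by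
      have := (intervalIntegral.intervalIntegrable_rpow' (a := 0) (b := 1)
        (r := p - 1) (by linarith))
      rwa [intervalIntegrable_iff_integrableOn_Ioc_of_le zero_le_one] at this
    refine lt_of_le_of_lt (lintegral_mono fun t => ?_) h1.lintegral_lt_top
    exact mul_le_of_le_one_left' prob_le_one
  · have h1 : IntegrableOn (fun u : ℝ => K * u ^ (p - 1 - s)) (Set.Ioi 1) :=
      (integrableOn_Ioi_rpow_of_lt (by linarith) zero_lt_one).const_mul K
    refine lt_of_le_of_lt (setLIntegral_mono' measurableSet_Ioi fun t ht => ?_)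
      h1.lintegral_lt_top
    have ht0 : (0 : ℝ) < t := zero_lt_one.trans ht
    rw [← ofReal_measureReal, ← ENNReal.ofReal_mul measureReal_nonneg]
    refine ENNReal.ofReal_le_ofReal ?_
    calc _ ≤ K * t ^ (-s) * t ^ (p - 1) := by
            gcongr
            exact h t ht0
      _ = _ := by rw [mul_assoc, ← Real.rpow_add ht0]; ring_nf

section Moments

variable {E : Type*} [NormedAddCommGroup E] [InnerProductSpace ℝ E] [FiniteDimensional ℝ E]
  [MeasurableSpace E] [BorelSpace E]

/-- The tail of a one-dimensional marginal beyond `r` is controlled by the mean of `1 - charFun`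
over `|t| ≤ 2 / r`. Since `1 - exp (-x) ≤ x`, this is of order `r ^ (-s)`. -/
theorem memLp_id_of_charFun_stable {μ : Measure E} [IsProbabilityMeasure μ] {s σ p : ℝ}
    (hs : 0 < s) (hσ : 0 < σ) (hp : 0 < p) (hps : p < s)
    (h : ∀ t : E, charFun μ t = ((Real.exp (-(σ * ‖t‖ ^ s)) : ℝ) : ℂ)) :
    MemLp id (ENNReal.ofReal p) μ := by
  have tail : ∀ a : E, ‖a‖ = 1 → MemLp (fun x => inner ℝ a x) (ENNReal.ofReal p) μ := by
    intro a ha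
    refine memLp_of_measureReal_gt_le_rpow (K := 2 * σ * 2 ^ s) (by fun_prop) hp hps
      fun r hr => (measureReal_abs_inner_gt_le_integral_charFun hr).trans ?_
    have hb : ‖∫ t in -2 * r⁻¹..2 * r⁻¹, 1 - charFun μ (t • a)‖ ≤
        (σ * (2 * r⁻¹) ^ s) * |2 * r⁻¹ - -2 * r⁻¹| := by
      refine intervalIntegral.norm_integral_le_of_norm_le_const fun t ht => ?_
      rw [Set.uIoc_of_le (by have := inv_pos.2 hr; linarith)] at ht
      have ht' : |t| ≤ 2 * r⁻¹ := abs_le.2 ⟨by linarith [ht.1], ht.2⟩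
      rw [h, norm_smul, ha, mul_one, Real.norm_eq_abs, ← Complex.ofReal_one, ← Complex.ofReal_sub,
        Complex.norm_real, Real.norm_eq_abs]
      have h0 : 0 ≤ σ * |t| ^ s := by positivity
      have h1 := Real.add_one_le_exp (-(σ * |t| ^ s))
      have h2 : Real.exp (-(σ * |t| ^ s)) ≤ 1 := Real.exp_le_one_iff.2 (by linarith)
      rw [abs_of_nonneg (by linarith)]
      calc _ ≤ σ * |t| ^ s := by linarith
        _ ≤ _ := by gcongr
    calc _ ≤ 2⁻¹ * r * ((σ * (2 * r⁻¹) ^ s) * |2 * r⁻¹ - -2 * r⁻¹|) := by gcongr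
      _ = _ := by
        have : 2 * r⁻¹ - -2 * r⁻¹ = 4 * r⁻¹ := by ring
        rw [this, abs_of_pos (by positivity), Real.mul_rpow (by norm_num) (by positivity),
          Real.inv_rpow hr.le, ← Real.rpow_neg hr.le]
        field_simp
        ring
  let b := stdOrthonormalBasis ℝ E
  have e : (id : E → E) = fun x => ∑ i, (inner ℝ (b i) x : ℝ) • b i := by
    ext x
    conv_lhs => rw [id, ← b.sum_repr x]
    simp_rw [b.repr_apply_apply]
  rw [e]
  refine memLp_finsetSum _ fun i _ => ?_
  exact (ContinuousLinearMap.toSpanSingleton ℝ (b i)).comp_memLp' (tail (b i) (b.orthonormal.1 i))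

/-- The tail estimate only reaches `p < s`. For `s = 2` the law is a rescaled standard Gaussian,
which has moments of every order. -/
theorem memLp_id_of_charFun_gaussian {μ : Measure E} [IsProbabilityMeasure μ] {σ : ℝ}
    (hσ : 0 < σ) (p : ℝ)
    (h : ∀ t : E, charFun μ t = ((Real.exp (-(σ * ‖t‖ ^ (2 : ℝ))) : ℝ) : ℂ)) :
    MemLp id (ENNReal.ofReal p) μ := by
  have hm : Measurable (fun x : E => √(2 * σ) • x) := by fun_prop
  have e : μ = (stdGaussian E).map (fun x => √(2 * σ) • x) := by
    have := Measure.isProbabilityMeasure_map (μ := stdGaussian E) hm.aemeasurable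
    refine Measure.ext_of_charFun (funext fun t => ?_)
    rw [charFun_map_smul, charFun_stdGaussian, h, norm_smul, Real.norm_of_nonneg (by positivity)]
    rw [Real.rpow_two, Complex.ofReal_exp]
    congr 1
    rw [← Complex.ofReal_pow, mul_pow, Real.sq_sqrt (by positivity)]
    push_cast
    ring
  rw [e, memLp_map_measure_iff (by fun_prop) hm.aemeasurable]
  exact (IsGaussian.memLp_id (stdGaussian E) (ENNReal.ofReal p) (by simp)).const_smul (√(2 * σ))

end Moments

/-! ### Linear forms in stable variables -/

section Stable

variable {𝕜 : Type*} [RCLike 𝕜] {s σ p : ℝ}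

theorem memLp_id_stableMeasure (hs : 0 < s) (hs2 : s ≤ 2) (hσ : 0 < σ) (hp : 0 < p)
    (h : p < s ∨ s = 2) : MemLp id (ENNReal.ofReal p) (stableMeasure 𝕜 s σ) := by
  rcases h with h | rfl
  · exact memLp_id_of_charFun_stable hs hσ hp h (charFun_stableMeasure hs hs2 hσ)
  · exact memLp_id_of_charFun_gaussian hσ p (charFun_stableMeasure hs hs2 hσ)

theorem charFun_map_const_mul (μ : Measure 𝕜) (a t : 𝕜) :
    charFun (μ.map (fun z => a * z)) t = charFun μ (starRingEnd 𝕜 a * t) := by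
  rw [charFun_apply, charFun_apply, integral_map (by fun_prop) (by fun_prop)]
  congr 1
  ext z
  have : (inner ℝ (a * z) t : ℝ) = inner ℝ z (starRingEnd 𝕜 a * t) := by
    simp only [RCLike.inner_apply, real_inner_eq_re_inner 𝕜, map_mul]
    congr 1
    ring
  rw [this]

/-- Linear forms in independent `s`-stable variables are again `s`-stable. -/
theorem map_sum_mul_stableMeasurePi (hs : 0 < s) (hs2 : s ≤ 2) (hσ : 0 < σ) {N : ℕ}
    (a : Fin N → 𝕜) :
    (stableMeasurePi 𝕜 N s σ).map (fun z => ∑ i, a i * z i) =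
      (stableMeasure 𝕜 s σ).map (fun z => ((∑ i, ‖a i‖ ^ s) ^ (1 / s) : ℝ) • z) := by
  have hp : ∀ i, IsProbabilityMeasure ((stableMeasure 𝕜 s σ).map (fun z => a i * z)) := fun i =>
    Measure.isProbabilityMeasure_map (by fun_prop)
  have e : (stableMeasurePi 𝕜 N s σ).map (fun z => ∑ i, a i * z i) =
      (Measure.pi fun i => (stableMeasure 𝕜 s σ).map (fun z => a i * z)).map
        (fun z => ∑ i, z i) := by
    rw [← Measure.pi_map_pi (f := fun i (z : 𝕜) => a i * z) (fun i => by fun_prop),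
      Measure.map_map (by fun_prop) (by fun_prop)]
    rfl
  have : IsProbabilityMeasure ((Measure.pi fun i => (stableMeasure 𝕜 s σ).map
      (fun z => a i * z)).map (fun z => ∑ i, z i)) :=
    Measure.isProbabilityMeasure_map (by fun_prop)
  have : IsProbabilityMeasure ((stableMeasure 𝕜 s σ).map
      (fun z => ((∑ i, ‖a i‖ ^ s) ^ (1 / s) : ℝ) • z)) :=
    Measure.isProbabilityMeasure_map (by fun_prop)
  rw [e]
  refine Measure.ext_of_charFun (funext fun t => ?_)
  rw [charFun_map_sum_pi_eq_prod, charFun_map_smul, Finset.prod_apply,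
    charFun_stableMeasure hs hs2 hσ]
  have h0 : 0 ≤ ∑ i, ‖a i‖ ^ s := by positivity
  -- Each factor depends only on `|a i| * |t|`, so the exponents add up to `-σ (∑ |a i| ^ s) |t| ^
  -- s`.
  simp_rw [charFun_map_const_mul, charFun_stableMeasure hs hs2 hσ]
  rw [← Complex.ofReal_prod, ← Real.exp_sum, norm_smul, Real.norm_of_nonneg (by positivity),
    Real.mul_rpow (by positivity) (norm_nonneg _), ← Real.rpow_mul h0, one_div_mul_cancel hs.ne',
    Real.rpow_one, Finset.sum_mul, Finset.mul_sum, ← Finset.sum_neg_distrib]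
  simp [Real.mul_rpow]

theorem lintegral_sum_mul_stableMeasurePi (hs : 0 < s) (hs2 : s ≤ 2) (hσ : 0 < σ) (hp : 0 < p)
    {N : ℕ} (a : Fin N → 𝕜) :
    ∫⁻ z, ‖∑ i, a i * z i‖ₑ ^ p ∂(stableMeasurePi 𝕜 N s σ) =
      (∫⁻ z, ‖z‖ₑ ^ p ∂(stableMeasure 𝕜 s σ)) *
        ENNReal.ofReal ((∑ i, ‖a i‖ ^ s) ^ (1 / s)) ^ p := by
  have h1 : ∫⁻ z, ‖∑ i, a i * z i‖ₑ ^ p ∂(stableMeasurePi 𝕜 N s σ) =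
      ∫⁻ z, ‖z‖ₑ ^ p ∂((stableMeasurePi 𝕜 N s σ).map (fun z => ∑ i, a i * z i)) := by
    rw [lintegral_map (by fun_prop) (by fun_prop)]
  rw [h1, map_sum_mul_stableMeasurePi hs hs2 hσ, lintegral_map (by fun_prop) (by fun_prop),
    ← lintegral_mul_const _ (by fun_prop)]
  refine lintegral_congr fun z => ?_
  rw [enorm_smul, ENNReal.mul_rpow_of_nonneg _ _ hp.le, mul_comm, Real.enorm_eq_ofReal]
  positivity

/-- A vanishing moment would force the Dirac mass at `0`, whose characteristic function is `1`,
whereas here its value at `1` is `exp (-σ) < 1`. -/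
theorem lintegral_stableMeasure_ne_zero (hs : 0 < s) (hs2 : s ≤ 2) (hσ : 0 < σ) (hp : 0 < p) :
    ∫⁻ z, ‖z‖ₑ ^ p ∂(stableMeasure 𝕜 s σ) ≠ 0 := by
  intro h
  rw [lintegral_eq_zero_iff (by fun_prop)] at h
  have h1 := charFun_stableMeasure hs hs2 hσ (1 : 𝕜)
  have h2 : charFun (stableMeasure 𝕜 s σ) (1 : 𝕜) = 1 := by
    rw [charFun_apply]
    have : ∀ᵐ z ∂(stableMeasure 𝕜 s σ),
        Complex.exp ((inner ℝ z (1 : 𝕜) : ℝ) * Complex.I) = 1 := by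
      filter_upwards [h] with z hz
      have : z = 0 := by simpa [ENNReal.rpow_eq_zero_iff, hp, hp.not_gt] using hz
      simp [this]
    rw [integral_congr_ae this]
    simp
  rw [h2] at h1
  have h3 : (1 : ℝ) = Real.exp (-(σ * ‖(1 : 𝕜)‖ ^ s)) := by exact_mod_cast h1
  have h4 : Real.exp (-(σ * ‖(1 : 𝕜)‖ ^ s)) < 1 := Real.exp_lt_one_iff.2 (by simpa using hσ)
  linarith

theorem lintegral_stableMeasure_ne_top (hs : 0 < s) (hs2 : s ≤ 2) (hσ : 0 < σ) (hp : 0 < p)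
    (h : p < s ∨ s = 2) : ∫⁻ z, ‖z‖ₑ ^ p ∂(stableMeasure 𝕜 s σ) ≠ ∞ := by
  have := (memLp_id_stableMeasure (𝕜 := 𝕜) hs hs2 hσ hp h).2
  rw [eLpNorm_lt_top_iff_lintegral_rpow_enorm_lt_top (by simpa) (by simp),
    ENNReal.toReal_ofReal hp.le] at this
  exact this.ne

theorem memLp_toLp_stableMeasurePi (hs : 0 < s) (hs2 : s ≤ 2) (hσ : 0 < σ) (hp : 0 < p)
    (h : p < s ∨ s = 2) (N : ℕ) (r : ℝ≥0∞) [Fact (1 ≤ r)] :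
    MemLp (fun z : Fin N → 𝕜 => (WithLp.toLp r z : PiLp r (fun _ : Fin N => 𝕜)))
      (ENNReal.ofReal p) (stableMeasurePi 𝕜 N s σ) := by
  have e : (fun z : Fin N → 𝕜 => (WithLp.toLp r z : PiLp r (fun _ : Fin N => 𝕜))) =
      fun z => ∑ i, z i • PiLp.single r i (1 : 𝕜) := by
    ext z j
    simp [Pi.single_apply]
  rw [e]
  refine memLp_finsetSum _ fun i _ => ?_
  have := (memLp_id_stableMeasure (𝕜 := 𝕜) hs hs2 hσ hp h).comp_measurePreserving
    (measurePreserving_eval (fun _ : Fin N => stableMeasure 𝕜 s σ) i)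
  exact (ContinuousLinearMap.toSpanSingleton 𝕜 (PiLp.single r i (1 : 𝕜) :
    PiLp r (fun _ : Fin N => 𝕜))).comp_memLp' this

end Stable

/-! ### The dual norm of `ℓ_r^N` -/

section DualNorm

variable {𝕜 : Type*} [RCLike 𝕜] {N : ℕ}

theorem apply_toLp_eq_sum {r : ℝ≥0∞} [Fact (1 ≤ r)]
    (γ : PiLp r (fun _ : Fin N => 𝕜) →L[𝕜] 𝕜) (z : Fin N → 𝕜) :
    γ (WithLp.toLp r z) = ∑ i, γ (PiLp.single r i 1) * z i := by
  have e : (WithLp.toLp r z : PiLp r (fun _ : Fin N => 𝕜)) =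
      ∑ i, z i • PiLp.single r i (1 : 𝕜) := by
    ext j
    simp [Pi.single_apply]
  rw [e, map_sum]
  simp [mul_comm]

/-- A functional on `ℓ_r^N` is norming on a vector with prescribed moduli. -/
theorem sum_norm_mul_le_opNorm {r : ℝ≥0∞} [Fact (1 ≤ r)]
    (γ : PiLp r (fun _ : Fin N => 𝕜) →L[𝕜] 𝕜) (g : Fin N → ℝ) (hg : ∀ i, 0 ≤ g i)
    (h : ∀ x : PiLp r (fun _ : Fin N => 𝕜), (∀ i, ‖x i‖ ≤ g i) → ‖x‖ ≤ 1) :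
    ∑ i, ‖γ (PiLp.single r i 1)‖ * g i ≤ ‖γ‖ := by
  set a : Fin N → 𝕜 := fun i => γ (PiLp.single r i 1) with ha
  -- The unimodular `u i` turn the coefficients into their moduli, so nothing cancels.
  choose u hu1 hu2 using fun i => RCLike.exists_norm_eq_mul_self (a i)
  have h1 : γ (WithLp.toLp r fun i => u i * (g i : 𝕜)) = ((∑ i, ‖a i‖ * g i : ℝ) : 𝕜) := by
    rw [apply_toLp_eq_sum]
    push_cast
    refine Finset.sum_congr rfl fun i _ => ?_
    calc γ (PiLp.single r i 1) * (u i * (g i : 𝕜)) = u i * a i * (g i : 𝕜) := by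
          simp only [ha]; ring
      _ = _ := congrArg (· * (g i : 𝕜)) (hu2 i).symm
  have h2 : ‖γ (WithLp.toLp r fun i => u i * (g i : 𝕜))‖ ≤ ‖γ‖ :=
    γ.unit_le_opNorm _ (h _ fun i => by simp [hu1, abs_of_nonneg (hg i)])
  rw [h1, RCLike.norm_ofReal] at h2
  exact (le_abs_self _).trans h2

/-- The dual of an `ℓ_r^N`-space carries the norm of the conjugate exponent. -/
theorem opNorm_piLp_eq {r r' : ℝ≥0∞} [Fact (1 ≤ r)] [h : ENNReal.HolderConjugate r r']
    (hr' : r' ≠ ∞) (γ : PiLp r (fun _ : Fin N => 𝕜) →L[𝕜] 𝕜) :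
    ‖γ‖ = (∑ i, ‖γ (PiLp.single r i 1)‖ ^ r'.toReal) ^ (1 / r'.toReal) := by
  set a : Fin N → 𝕜 := fun i => γ (PiLp.single r i 1) with ha
  have hγ : ∀ x : PiLp r (fun _ : Fin N => 𝕜), ‖γ x‖ ≤ ∑ i, ‖a i‖ * ‖x i‖ := fun x => by
    have := apply_toLp_eq_sum γ x.ofLp
    rw [WithLp.toLp_ofLp] at this
    rw [this]
    exact (norm_sum_le _ _).trans (Finset.sum_le_sum fun i _ => (norm_mul _ _).le)
  rcases eq_or_ne r ∞ with rfl | hr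
  · have hr1 : r' = 1 := by
      have := h.conj_eq
      simpa using this
    subst hr1
    simp only [ENNReal.toReal_one, Real.rpow_one, div_one]
    refine le_antisymm (γ.opNorm_le_bound (by positivity) fun x => (hγ x).trans ?_) ?_
    · rw [Finset.sum_mul]
      gcongr with i
      exact PiLp.norm_apply_le x i
    · simpa using sum_norm_mul_le_opNorm γ (fun _ => 1) (fun _ => zero_le_one) fun x hx => by
        rw [PiLp.norm_eq_ciSup]
        exact Real.iSup_le hx zero_le_one
  · have hc : r.toReal.HolderConjugate r'.toReal := h.toReal_of_ne_top hr hr'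
    refine le_antisymm (γ.opNorm_le_bound (by positivity) fun x => (hγ x).trans ?_) ?_
    · rw [PiLp.norm_eq_sum hc.pos]
      have := Real.inner_le_Lp_mul_Lq Finset.univ (fun i => ‖a i‖) (fun i => ‖x i‖) hc.symm
      simpa using this
    -- An extremal vector for Hölder's inequality.
    · obtain ⟨g, hg1, hg2⟩ := (NNReal.isGreatest_Lp Finset.univ (fun i => ‖a i‖₊) hc.symm).1
      have hg3 : ∑ i, ‖a i‖ * (g i : ℝ) = (∑ i, ‖a i‖ ^ r'.toReal) ^ (1 / r'.toReal) := by
        have := congrArg (fun t : ℝ≥0 => (t : ℝ)) hg2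
        simpa using this
      rw [← hg3]
      refine sum_norm_mul_le_opNorm γ (fun i => g i) (fun i => (g i).2) fun x hx => ?_
      rw [PiLp.norm_eq_sum hc.pos]
      refine Real.rpow_le_one (by positivity) ?_ hc.one_div_nonneg
      have hg1' : ∑ i, (g i : ℝ) ^ r.toReal ≤ 1 := by exact_mod_cast hg1
      refine le_trans ?_ hg1'
      gcongr with i
      exact hx i

end DualNorm

/-! ### Upper bound for scalar forms -/

section ScalarBound

variable {𝕜 : Type*} [RCLike 𝕜] {E : Type*} [NormedAddCommGroup E] [NormedSpace 𝕜 E]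
  [MeasurableSpace E] [BorelSpace E] [SecondCountableTopology E]

/-- The summing estimate for scalar valued multilinear forms, when the dual norm of `E` is an
`L_p`-norm with respect to `ν`. -/
theorem sum_enorm_rpow_le_lintegral_of_form {ν : Measure E} [IsProbabilityMeasure ν] {p : ℝ}
    {c : ℝ≥0∞} (hν : ∀ γ : E →L[𝕜] 𝕜, ∫⁻ z, ‖γ z‖ₑ ^ p ∂ν = c * ‖γ‖ₑ ^ p) :
    ∀ {m : ℕ} (t : ContinuousMultilinearMap 𝕜 (fun _ : Fin m => E) 𝕜) (J : Fin m → ℕ)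
      (x : ∀ i, Fin (J i) → E) (W : Fin m → ℝ≥0∞)
      (_ : ∀ i (γ : E →L[𝕜] 𝕜), ∑ j, ‖γ (x i j)‖ₑ ^ p ≤ W i * ‖γ‖ₑ ^ p),
      c ^ m * ∑ j : ∀ i, Fin (J i), ‖t fun i => x i (j i)‖ₑ ^ p ≤
        (∏ i, W i) * ∫⁻ z, ‖t z‖ₑ ^ p ∂(Measure.pi fun _ : Fin m => ν) := by
  intro m
  induction m with
  | zero =>
    intro t J x W hW
    have e : ∀ z : Fin 0 → E, t z = t 0 := fun z => congrArg t (Subsingleton.elim _ _)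
    simp [e]
  | succ m ih =>
    intro t J x W hW
    have tm : Measurable fun w : E × (Fin m → E) => ‖t (Fin.cons w.1 w.2)‖ₑ ^ p := by
      have : Continuous fun w : E × (Fin m → E) => t (Fin.cons w.1 w.2) :=
        t.cont.comp (continuous_pi fun i => by
          refine Fin.cases ?_ (fun k => ?_) i
          · simpa using continuous_fst
          · simp only [Fin.cons_succ]; fun_prop)
      exact (this.enorm.measurable).pow_const p
    have hsum : ∑ j : ∀ i, Fin (J i), ‖t fun i => x i (j i)‖ₑ ^ p =
        ∑ j0 : Fin (J 0), ∑ j : ∀ i : Fin m, Fin (J i.succ),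
          ‖t.curryLeft (x 0 j0) fun i => x i.succ (j i)‖ₑ ^ p := by
      rw [← (Fin.consEquiv fun i => Fin (J i)).sum_comp, Fintype.sum_prod_type]
      refine Finset.sum_congr rfl fun j0 _ => Finset.sum_congr rfl fun j _ => ?_
      rw [ContinuousMultilinearMap.curryLeft_apply]
      congr 3
      ext i
      refine Fin.cases ?_ (fun k => ?_) i <;> simp [Fin.consEquiv]
    have hint : ∫⁻ z, ‖t z‖ₑ ^ p ∂(Measure.pi fun _ : Fin (m + 1) => ν) =
        ∫⁻ z, ∫⁻ z0, ‖t (Fin.cons z0 z)‖ₑ ^ p ∂ν ∂(Measure.pi fun _ : Fin m => ν) := by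
      have hmp := (measurePreserving_piFinSuccAbove (fun _ : Fin (m + 1) => ν) 0).symm
      rw [← hmp.lintegral_comp_emb (MeasurableEquiv.measurableEmbedding _)]
      have : ∀ w : E × (Fin m → E),
          (MeasurableEquiv.piFinSuccAbove (fun _ : Fin (m + 1) => E) 0).symm w =
            Fin.cons w.1 w.2 := fun w => by
        simp [MeasurableEquiv.piFinSuccAbove, Fin.insertNthEquiv]
      simp_rw [this]
      rw [lintegral_prod_symm _ tm.aemeasurable]
    -- With the other variables frozen, the form is a functional in the first one, to which both the
    -- weak estimate and the `L_p` formula for its norm apply.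
    have h1 : ∀ z : Fin m → E, c * ∑ j0, ‖t (Fin.cons (x 0 j0) z)‖ₑ ^ p ≤
        W 0 * ∫⁻ z0, ‖t (Fin.cons z0 z)‖ₑ ^ p ∂ν := fun z => by
      let γ : E →L[𝕜] 𝕜 := (ContinuousMultilinearMap.apply 𝕜 (fun _ : Fin m => E) 𝕜 z).comp
        t.curryLeft
      have hγ : ∀ y, γ y = t (Fin.cons y z) := fun y => rfl
      simp_rw [← hγ, hν]
      calc _ ≤ c * (W 0 * ‖γ‖ₑ ^ p) := by gcongr; exact hW 0 γ
        _ = _ := by ring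
    have tm0 : ∀ y, Measurable fun z : Fin m → E => ‖t (Fin.cons y z)‖ₑ ^ p := fun y =>
      tm.comp (measurable_const.prodMk measurable_id)
    calc c ^ (m + 1) * ∑ j : ∀ i, Fin (J i), ‖t fun i => x i (j i)‖ₑ ^ p
        = c * ∑ j0 : Fin (J 0), c ^ m * ∑ j : ∀ i : Fin m, Fin (J i.succ),
          ‖t.curryLeft (x 0 j0) fun i => x i.succ (j i)‖ₑ ^ p := by
          rw [hsum, ← Finset.mul_sum]; ring
      _ ≤ c * ∑ j0 : Fin (J 0), (∏ i : Fin m, W i.succ) *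
          ∫⁻ z, ‖t.curryLeft (x 0 j0) z‖ₑ ^ p ∂(Measure.pi fun _ : Fin m => ν) := by
          refine mul_le_mul_right (Finset.sum_le_sum fun j0 _ => ?_) _
          exact ih (t.curryLeft (x 0 j0)) (fun i => J i.succ) (fun i => x i.succ)
            (fun i => W i.succ) (fun i γ => hW i.succ γ)
      _ = (∏ i : Fin m, W i.succ) * ∫⁻ z, c * ∑ j0, ‖t (Fin.cons (x 0 j0) z)‖ₑ ^ p
            ∂(Measure.pi fun _ : Fin m => ν) := by
          rw [lintegral_const_mul _ (Finset.measurable_fun_sum _ fun j0 _ => tm0 _),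
            lintegral_finsetSum _ fun j0 _ => tm0 _, ← Finset.mul_sum]
          simp_rw [ContinuousMultilinearMap.curryLeft_apply]
          ring
      _ ≤ (∏ i : Fin m, W i.succ) * ∫⁻ z, W 0 * ∫⁻ z0, ‖t (Fin.cons z0 z)‖ₑ ^ p ∂ν
            ∂(Measure.pi fun _ : Fin m => ν) := by
          exact mul_le_mul_right (lintegral_mono h1) _
      _ = _ := by
          rw [lintegral_const_mul _ (Measurable.lintegral_prod_left' tm), hint,
            Fin.prod_univ_succ]
          ring

end ScalarBound

/-! ### Weak norms in extended nonnegative reals -/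

section WeakNorm

variable {𝕜 : Type*} [RCLike 𝕜] {E : Type*} [NormedAddCommGroup E] [NormedSpace 𝕜 E]

theorem enorm_rpow_eq_ofReal {F : Type*} [NormedAddCommGroup F] {p : ℝ} (hp : 0 ≤ p) (v : F) :
    ‖v‖ₑ ^ p = ENNReal.ofReal (‖v‖ ^ p) := by
  rw [← ENNReal.ofReal_rpow_of_nonneg (norm_nonneg _) hp, ofReal_norm]

theorem sum_enorm_rpow_eq_ofReal {F ι : Type*} [NormedAddCommGroup F] [Fintype ι] {p : ℝ}
    (hp : 0 ≤ p) (v : ι → F) :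
    ∑ j, ‖v j‖ₑ ^ p = ENNReal.ofReal (∑ j, ‖v j‖ ^ p) := by
  rw [ENNReal.ofReal_sum_of_nonneg fun j _ => by positivity]
  exact Finset.sum_congr rfl fun j _ => enorm_rpow_eq_ofReal hp _

theorem weakLpNorm_nonneg (p : ℝ) {n : ℕ} (y : Fin n → E) : 0 ≤ weakLpNorm 𝕜 p y := by
  refine Real.sSup_nonneg ?_
  rintro _ ⟨γ, -, rfl⟩
  positivity

theorem le_weakLpNorm {p : ℝ} (hp : 0 < p) {n : ℕ} (y : Fin n → E) (γ : E →L[𝕜] 𝕜)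
    (hγ : ‖γ‖ ≤ 1) : (∑ j, ‖γ (y j)‖ ^ p) ^ (1 / p) ≤ weakLpNorm 𝕜 p y := by
  -- Boundedness by the strong `ℓ_p`-norm matters: the supremum of an unbounded real set defaults to
  -- `0`.
  refine le_csSup ⟨(∑ j, ‖y j‖ ^ p) ^ (1 / p), ?_⟩ ⟨γ, hγ, rfl⟩
  rintro _ ⟨γ, hγ, rfl⟩
  gcongr with j
  exact (γ.le_of_opNorm_le hγ _).trans (one_mul _).le

theorem sum_enorm_rpow_le_weakLpNorm {p : ℝ} (hp : 0 < p) {n : ℕ} (y : Fin n → E)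
    (γ : E →L[𝕜] 𝕜) :
    ∑ j, ‖γ (y j)‖ₑ ^ p ≤ ENNReal.ofReal (weakLpNorm 𝕜 p y) ^ p * ‖γ‖ₑ ^ p := by
  rw [sum_enorm_rpow_eq_ofReal hp.le, enorm_rpow_eq_ofReal hp.le,
    ENNReal.ofReal_rpow_of_nonneg (weakLpNorm_nonneg _ _) hp.le,
    ← ENNReal.ofReal_mul (Real.rpow_nonneg (weakLpNorm_nonneg _ _) _)]
  refine ENNReal.ofReal_le_ofReal ?_
  rcases eq_or_ne γ 0 with rfl | h0
  · simp [Real.zero_rpow hp.ne']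
  have hn : 0 < ‖γ‖ := norm_pos_iff.2 h0
  have h1 := le_weakLpNorm hp y (((‖γ‖⁻¹ : ℝ) : 𝕜) • γ) (by
    rw [norm_smul]; simp [hn.ne'])
  rw [one_div, Real.rpow_inv_le_iff_of_pos (by positivity) (weakLpNorm_nonneg _ _) hp] at h1
  have h2 : ∑ j, ‖γ (y j)‖ ^ p =
      (∑ j, ‖(((‖γ‖⁻¹ : ℝ) : 𝕜) • γ) (y j)‖ ^ p) * ‖γ‖ ^ p := by
    rw [Finset.sum_mul]
    refine Finset.sum_congr rfl fun j _ => ?_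
    rw [← Real.mul_rpow (norm_nonneg _) hn.le, _root_.smul_apply, norm_smul,
      RCLike.norm_ofReal, abs_of_pos (inv_pos.2 hn), mul_comm, mul_inv_cancel_left₀ hn.ne']
  rw [h2]
  gcongr

theorem ofReal_weakLpNorm_rpow_le {p : ℝ} (hp : 0 < p) {n : ℕ} (y : Fin n → E) {B : ℝ≥0∞}
    (hB : ∀ γ : E →L[𝕜] 𝕜, ‖γ‖ ≤ 1 → ∑ j, ‖γ (y j)‖ₑ ^ p ≤ B) :
    ENNReal.ofReal (weakLpNorm 𝕜 p y) ^ p ≤ B := by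
  rcases eq_or_ne B ∞ with rfl | hB'
  · simp
  rw [ENNReal.ofReal_rpow_of_nonneg (weakLpNorm_nonneg _ _) hp.le]
  refine ENNReal.ofReal_le_of_le_toReal ?_
  rw [← Real.le_rpow_inv_iff_of_pos (weakLpNorm_nonneg _ _) ENNReal.toReal_nonneg hp]
  refine Real.sSup_le ?_ (by positivity)
  rintro _ ⟨γ, hγ, rfl⟩
  rw [one_div]
  refine Real.rpow_le_rpow (by positivity) ?_ (by positivity)
  have := hB γ hγ
  rw [sum_enorm_rpow_eq_ofReal hp.le] at this
  exact (ENNReal.ofReal_le_iff_le_toReal hB').1 this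

/-- Without roots and in `ℝ≥0∞`, the inequality can be compared directly with lower integrals. -/
theorem isMultipleSummingConst_iff_enorm {m : ℕ} {F : Type*} [NormedAddCommGroup F]
    [NormedSpace 𝕜 F] {p : ℝ} (hp : 0 < p)
    (T : ContinuousMultilinearMap 𝕜 (fun _ : Fin m => E) F) {C : ℝ} (hC : 0 ≤ C) :
    IsMultipleSummingConst p T C ↔ ∀ (J : Fin m → ℕ) (x : ∀ i, Fin (J i) → E),
      ∑ j : ∀ i, Fin (J i), ‖T fun i => x i (j i)‖ₑ ^ p ≤
        ENNReal.ofReal C ^ p * ∏ i, ENNReal.ofReal (weakLpNorm 𝕜 p (x i)) ^ p := by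
  refine forall₂_congr fun J x => ?_
  have hw : 0 ≤ ∏ i, weakLpNorm 𝕜 p (x i) := Finset.prod_nonneg fun i _ => weakLpNorm_nonneg _ _
  rw [one_div, Real.rpow_inv_le_iff_of_pos (by positivity) (by positivity) hp,
    sum_enorm_rpow_eq_ofReal hp.le, ENNReal.prod_rpow_of_nonneg hp.le,
    ← ENNReal.ofReal_prod_of_nonneg fun i _ => weakLpNorm_nonneg _ _,
    ← ENNReal.mul_rpow_of_nonneg _ _ hp.le, ← ENNReal.ofReal_mul hC,
    ENNReal.ofReal_rpow_of_nonneg (by positivity) hp.le,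
    ENNReal.ofReal_le_ofReal_iff (by positivity)]

end WeakNorm

/-! ### Upper bound for vector-valued maps -/

section VectorBound

variable {𝕜 : Type*} [RCLike 𝕜] {E : Type*} [NormedAddCommGroup E] [NormedSpace 𝕜 E]

/-- The range need not be a subspace, but multilinearity puts it in the span of the finitely many
values on tuples of basis vectors. The local structure of the target is applied to this span. -/
theorem exists_finiteDimensional_range_subset [FiniteDimensional 𝕜 E]
    {X : Type*} [NormedAddCommGroup X] [NormedSpace 𝕜 X] {m : ℕ}
    (T : ContinuousMultilinearMap 𝕜 (fun _ : Fin m => E) X) :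
    ∃ M : Submodule 𝕜 X, FiniteDimensional 𝕜 M ∧ ∀ z, T z ∈ M := by
  let b := Module.finBasis 𝕜 E
  refine ⟨Submodule.span 𝕜 (Set.range fun k : Fin m → Fin _ => T fun i => b (k i)),
    FiniteDimensional.span_of_finite 𝕜 (Set.finite_range _), fun z => ?_⟩
  have e : z = fun i => ∑ k, b.repr (z i) k • b k := by
    ext i
    rw [b.sum_repr]
  rw [e, T.map_sum]
  refine Submodule.sum_mem _ fun k _ => ?_
  rw [T.map_smul_univ]
  exact Submodule.smul_mem _ _ (Submodule.subset_span ⟨k, rfl⟩)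

variable  [MeasurableSpace E] [BorelSpace E] [SecondCountableTopology E]

/-- The summing estimate for maps into a space that embeds isometrically into `L_p`. -/
theorem sum_enorm_rpow_le_lintegral_of_embedding {ν : Measure E} [IsProbabilityMeasure ν]
    {p : ℝ} {c : ℝ≥0∞}
    (hν : ∀ γ : E →L[𝕜] 𝕜, ∫⁻ z, ‖γ z‖ₑ ^ p ∂ν = c * ‖γ‖ₑ ^ p)
    {Y : Type*} [NormedAddCommGroup Y] [NormedSpace 𝕜 Y]
    {Ω : Type*} [MeasurableSpace Ω] {ω : Measure Ω} [SFinite ω] (L : Ω → Y →L[𝕜] 𝕜)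
    (hω : ∀ y : Y, ∫⁻ w, ‖L w y‖ₑ ^ p ∂ω = ‖y‖ₑ ^ p)
    {m : ℕ} (U : ContinuousMultilinearMap 𝕜 (fun _ : Fin m => E) Y)
    (hmeas : Measurable fun a : (Fin m → E) × Ω => ‖L a.2 (U a.1)‖ₑ ^ p)
    (J : Fin m → ℕ) (x : ∀ i, Fin (J i) → E) (W : Fin m → ℝ≥0∞)
    (hW : ∀ i (γ : E →L[𝕜] 𝕜), ∑ j, ‖γ (x i j)‖ₑ ^ p ≤ W i * ‖γ‖ₑ ^ p) :
    c ^ m * ∑ j : ∀ i, Fin (J i), ‖U fun i => x i (j i)‖ₑ ^ p ≤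
      (∏ i, W i) * ∫⁻ z, ‖U z‖ₑ ^ p ∂(Measure.pi fun _ : Fin m => ν) := by
  -- Both norms become integrals over `w`; after Tonelli, the scalar estimate holds for the form `L
  -- w ∘ U` at every `w`.
  simp_rw [← hω]
  have hm1 : ∀ y, Measurable fun w => ‖L w (U y)‖ₑ ^ p := fun y =>
    hmeas.comp (measurable_const.prodMk measurable_id)
  rw [lintegral_lintegral_swap hmeas.aemeasurable,
    ← lintegral_finsetSum _ fun j _ => hm1 _,
    ← lintegral_const_mul _ (Finset.measurable_fun_sum _ fun j _ => hm1 _),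
    ← lintegral_const_mul _ (Measurable.lintegral_prod_left' hmeas)]
  exact lintegral_mono fun w =>
    sum_enorm_rpow_le_lintegral_of_form hν ((L w).compContinuousMultilinearMap U) J x W hW

theorem sum_enorm_rpow_le_lintegral_of_representation {ν : Measure E} [IsProbabilityMeasure ν]
    {p : ℝ} {c : ℝ≥0∞}
    (hν : ∀ γ : E →L[𝕜] 𝕜, ∫⁻ z, ‖γ z‖ₑ ^ p ∂ν = c * ‖γ‖ₑ ^ p)
    {q : ℝ≥0∞} [Fact (1 ≤ q)] {n : ℕ} {ω : Measure (Fin n → 𝕜)} [SFinite ω]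
    (hω : ∀ y : PiLp q (fun _ : Fin n => 𝕜), ∫⁻ w, ‖∑ i, y i * w i‖ₑ ^ p ∂ω = ‖y‖ₑ ^ p)
    {m : ℕ} (U : ContinuousMultilinearMap 𝕜 (fun _ : Fin m => E) (PiLp q (fun _ : Fin n => 𝕜)))
    (J : Fin m → ℕ) (x : ∀ i, Fin (J i) → E) (W : Fin m → ℝ≥0∞)
    (hW : ∀ i (γ : E →L[𝕜] 𝕜), ∑ j, ‖γ (x i j)‖ₑ ^ p ≤ W i * ‖γ‖ₑ ^ p) :
    c ^ m * ∑ j : ∀ i, Fin (J i), ‖U fun i => x i (j i)‖ₑ ^ p ≤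
      (∏ i, W i) * ∫⁻ z, ‖U z‖ₑ ^ p ∂(Measure.pi fun _ : Fin m => ν) := by
  let L : (Fin n → 𝕜) → (PiLp q (fun _ : Fin n => 𝕜) →L[𝕜] 𝕜) := fun w =>
    ∑ i, w i • (PiLp.proj q (fun _ : Fin n => 𝕜) i)
  have hL : ∀ w y, L w y = ∑ i, y i * w i := fun w y => by
    simp [L, mul_comm]
  refine sum_enorm_rpow_le_lintegral_of_embedding hν (ω := ω) L (fun y => ?_) U ?_ J x W hW
  · simp_rw [hL]
    exact hω y
  · simp_rw [hL]
    have hU : Continuous fun z => (U z).ofLp := (PiLp.continuous_ofLp q _).comp U.cont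
    have : Continuous fun a : (Fin m → E) × (Fin n → 𝕜) => ∑ i, (U a.1) i * a.2 i :=
      continuous_finsetSum _ fun i _ =>
        (((continuous_apply i).comp hU).comp continuous_fst).mul
          ((continuous_apply i).comp continuous_snd)
    exact this.enorm.measurable.pow_const p

/-- The summing estimate for maps into an `ℒ^g_{q,1}`-space. -/
theorem sum_enorm_rpow_le_lintegral_of_isLgSpace [FiniteDimensional 𝕜 E]
    {ν : Measure E} [IsProbabilityMeasure ν] {p : ℝ} (hp : 0 < p) {c : ℝ≥0∞}
    (hν : ∀ γ : E →L[𝕜] 𝕜, ∫⁻ z, ‖γ z‖ₑ ^ p ∂ν = c * ‖γ‖ₑ ^ p)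
    {q : ℝ≥0∞} [Fact (1 ≤ q)]
    (hq : ∀ n : ℕ, ∃ ω : Measure (Fin n → 𝕜), SFinite ω ∧
      ∀ y : PiLp q (fun _ : Fin n => 𝕜), ∫⁻ w, ‖∑ i, y i * w i‖ₑ ^ p ∂ω = ‖y‖ₑ ^ p)
    {X : Type*} [NormedAddCommGroup X] [NormedSpace 𝕜 X] (hX : IsLgSpace 𝕜 q 1 X)
    {m : ℕ} (T : ContinuousMultilinearMap 𝕜 (fun _ : Fin m => E) X)
    (J : Fin m → ℕ) (x : ∀ i, Fin (J i) → E) (W : Fin m → ℝ≥0∞)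
    (hW : ∀ i (γ : E →L[𝕜] 𝕜), ∑ j, ‖γ (x i j)‖ₑ ^ p ≤ W i * ‖γ‖ₑ ^ p) :
    c ^ m * ∑ j : ∀ i, Fin (J i), ‖T fun i => x i (j i)‖ₑ ^ p ≤
      (∏ i, W i) * ∫⁻ z, ‖T z‖ₑ ^ p ∂(Measure.pi fun _ : Fin m => ν) := by
  obtain ⟨M, hM, hTM⟩ := exists_finiteDimensional_range_subset T
  set A := c ^ m * ∑ j : ∀ i, Fin (J i), ‖T fun i => x i (j i)‖ₑ ^ p with hA
  set B := (∏ i, W i) * ∫⁻ z, ‖T z‖ₑ ^ p ∂(Measure.pi fun _ : Fin m => ν) with hB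
  -- Passing to `ℓ_q^n` by `R` and back by `S` costs `(‖S‖ ‖R‖) ^ p`.
  have key : ∀ ε : ℝ, 0 < ε → A ≤ ENNReal.ofReal (1 + ε) ^ p * B := by
    intro ε hε
    obtain ⟨n, R, S, hSR, hn⟩ := hX M hM ε hε
    obtain ⟨ω, hω, hω'⟩ := hq n
    let U := R.compContinuousMultilinearMap (T.codRestrict M hTM)
    have hU : ∀ z, T z = S (U z) := fun z => (hSR ⟨T z, hTM z⟩).symm
    have h1 : ∀ z, ‖T z‖ₑ ^ p ≤ ‖S‖ₑ ^ p * ‖U z‖ₑ ^ p := fun z => by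
      rw [hU, ← ENNReal.mul_rpow_of_nonneg _ _ hp.le]
      exact ENNReal.rpow_le_rpow (S.le_opENorm _) hp.le
    have h2 : ∀ z, ‖U z‖ₑ ^ p ≤ ‖R‖ₑ ^ p * ‖T z‖ₑ ^ p := fun z => by
      rw [← ENNReal.mul_rpow_of_nonneg _ _ hp.le]
      exact ENNReal.rpow_le_rpow (R.le_opENorm ⟨T z, hTM z⟩) hp.le
    have h3 : ‖S‖ₑ ^ p * ‖R‖ₑ ^ p ≤ ENNReal.ofReal (1 + ε) ^ p := by
      rw [← ENNReal.mul_rpow_of_nonneg _ _ hp.le]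
      refine ENNReal.rpow_le_rpow ?_ hp.le
      rw [← ofReal_norm, ← ofReal_norm, ← ENNReal.ofReal_mul (norm_nonneg _)]
      exact ENNReal.ofReal_le_ofReal hn
    have hTm : Measurable fun z => ‖T z‖ₑ ^ p := T.cont.enorm.measurable.pow_const p
    calc A ≤ c ^ m * ∑ j : ∀ i, Fin (J i), ‖S‖ₑ ^ p * ‖U fun i => x i (j i)‖ₑ ^ p := by
          rw [hA]
          exact mul_le_mul_right (Finset.sum_le_sum fun j _ => h1 _) _
      _ = ‖S‖ₑ ^ p * (c ^ m * ∑ j : ∀ i, Fin (J i), ‖U fun i => x i (j i)‖ₑ ^ p) := by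
          rw [← Finset.mul_sum]; ring
      _ ≤ ‖S‖ₑ ^ p * ((∏ i, W i) * ∫⁻ z, ‖U z‖ₑ ^ p ∂(Measure.pi fun _ : Fin m => ν)) :=
          mul_le_mul_right
            (sum_enorm_rpow_le_lintegral_of_representation hν hω' U J x W hW) _
      _ ≤ ‖S‖ₑ ^ p * ((∏ i, W i) *
            ∫⁻ z, ‖R‖ₑ ^ p * ‖T z‖ₑ ^ p ∂(Measure.pi fun _ : Fin m => ν)) :=
          mul_le_mul_right (mul_le_mul_right (lintegral_mono h2) _) _
      _ = (‖S‖ₑ ^ p * ‖R‖ₑ ^ p) * B := by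
          rw [lintegral_const_mul _ hTm]; ring
      _ ≤ _ := mul_le_mul_left h3 _
  rcases eq_or_ne B ∞ with hB' | hB'
  · rw [hB']; exact le_top
  have hlim : Tendsto (fun ε : ℝ => ENNReal.ofReal (1 + ε) ^ p * B) (𝓝[>] 0)
      (𝓝 (ENNReal.ofReal (1 + 0) ^ p * B)) := by
    refine ENNReal.Tendsto.mul_const ?_ (Or.inr hB')
    refine tendsto_nhdsWithin_of_tendsto_nhds ?_
    refine Continuous.tendsto (f := fun ε : ℝ => ENNReal.ofReal (1 + ε) ^ p) ?_ 0
    exact ENNReal.continuous_rpow_const.comp (ENNReal.continuous_ofReal.comp (by fun_prop))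
  have := ge_of_tendsto hlim (eventually_mem_nhdsWithin.mono fun ε hε => key ε hε)
  simpa using this

end VectorBound

/-! ### Lower bound by discretization -/

section Discretization

/-- Whichever of `η * a` and `b` is larger absorbs the other term. This replaces the triangle
inequality in `L_p`, which fails for `p < 1`; the factor of `a ^ p` tends to `1` as `η → 0`. -/
theorem ENNReal.add_rpow_le_mul_add_mul {p : ℝ} (hp : 0 < p) {η : ℝ≥0∞} (h0 : η ≠ 0)
    (ht : η ≠ ∞) (a b : ℝ≥0∞) :
    (a + b) ^ p ≤ (1 + η) ^ p * a ^ p + (1 + η⁻¹) ^ p * b ^ p := by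
  rw [← ENNReal.mul_rpow_of_nonneg _ _ hp.le, ← ENNReal.mul_rpow_of_nonneg _ _ hp.le]
  rcases le_total b (η * a) with h | h
  · refine le_trans (ENNReal.rpow_le_rpow ?_ hp.le) le_self_add
    rw [add_mul, one_mul]
    gcongr
  · refine le_trans (ENNReal.rpow_le_rpow ?_ hp.le) le_add_self
    have : a ≤ η⁻¹ * b := by
      calc a = η⁻¹ * (η * a) := by rw [← mul_assoc, ENNReal.inv_mul_cancel h0 ht, one_mul]
        _ ≤ _ := by gcongr
    rw [add_mul, one_mul, add_comm]
    gcongr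

variable {𝕜 : Type*} [RCLike 𝕜] {E : Type*} [NormedAddCommGroup E] [NormedSpace 𝕜 E]
  [MeasurableSpace E] {X : Type*} [NormedAddCommGroup X] [NormedSpace 𝕜 X]

/-- The summing inequality for finitely valued random vectors. -/
theorem lintegral_le_of_isMultipleSummingConst_of_finite {ν : Measure E} [IsProbabilityMeasure ν]
    {p : ℝ} (hp : 0 < p) {m : ℕ} (T : ContinuousMultilinearMap 𝕜 (fun _ : Fin m => E) X)
    {C : ℝ} (hC : 0 ≤ C) (hT : IsMultipleSummingConst p T C)
    {J : ℕ} (e : Fin J → E) {κ : E → Fin J} (hκ : Measurable κ) {B : ℝ≥0∞}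
    (hB : ∀ γ : E →L[𝕜] 𝕜, ‖γ‖ ≤ 1 → ∫⁻ z, ‖γ (e (κ z))‖ₑ ^ p ∂ν ≤ B) :
    ∫⁻ z, ‖T fun i => e (κ (z i))‖ₑ ^ p ∂(Measure.pi fun _ : Fin m => ν) ≤
      ENNReal.ofReal C ^ p * B ^ m := by
  have hpr : IsProbabilityMeasure (ν.map κ) := Measure.isProbabilityMeasure_map hκ.aemeasurable
  -- The weights satisfy `|d j| ^ p = a j`, the probability of the value `e j`, so sums over the
  -- weighted vectors are integrals.
  let a : Fin J → ℝ≥0∞ := fun j => (ν.map κ) {j}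
  let d : Fin J → 𝕜 := fun j => (((a j).toReal ^ p⁻¹ : ℝ) : 𝕜)
  have hd : ∀ j, ‖d j‖ₑ ^ p = a j := fun j => by
    rw [enorm_rpow_eq_ofReal hp.le, RCLike.norm_ofReal, abs_of_nonneg (by positivity),
      Real.rpow_inv_rpow ENNReal.toReal_nonneg hp.ne', ENNReal.ofReal_toReal (measure_ne_top _ _)]
  have hprod : ∀ j : Fin m → Fin J, ‖∏ i, d (j i)‖ₑ = ∏ i, ‖d (j i)‖ₑ := fun j => by
    simp_rw [← ofReal_norm]
    rw [norm_prod, ENNReal.ofReal_prod_of_nonneg fun i _ => norm_nonneg _]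
  have hsum := (isMultipleSummingConst_iff_enorm hp T hC).1 hT (fun _ => J)
    (fun _ j => d j • e j)
  have h1 : ∫⁻ z, ‖T fun i => e (κ (z i))‖ₑ ^ p ∂(Measure.pi fun _ : Fin m => ν) =
      ∑ j : Fin m → Fin J, ‖T fun i => d (j i) • e (j i)‖ₑ ^ p := by
    have : ∫⁻ z, ‖T fun i => e (κ (z i))‖ₑ ^ p ∂(Measure.pi fun _ : Fin m => ν) =
        ∫⁻ j : Fin m → Fin J, ‖T fun i => e (j i)‖ₑ ^ p
          ∂(Measure.pi fun _ : Fin m => ν.map κ) := by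
      rw [← Measure.pi_map_pi (f := fun _ : Fin m => κ) (fun i => hκ.aemeasurable),
        lintegral_map (measurable_of_countable _) (by fun_prop)]
    rw [this, lintegral_fintype]
    refine Finset.sum_congr rfl fun j _ => ?_
    rw [Measure.pi_singleton, T.map_smul_univ, enorm_smul, ENNReal.mul_rpow_of_nonneg _ _ hp.le,
      mul_comm, hprod, ← ENNReal.prod_rpow_of_nonneg hp.le]
    simp_rw [hd]
    rfl
  rw [h1]
  refine hsum.trans (mul_le_mul_right ?_ _)
  rw [Finset.prod_const, Finset.card_univ, Fintype.card_fin]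
  refine pow_le_pow_left' (ofReal_weakLpNorm_rpow_le hp _ fun γ hγ => ?_) m
  refine le_trans (le_of_eq ?_) (hB γ hγ)
  rw [← lintegral_map (f := fun j => ‖γ (e j)‖ₑ ^ p) (measurable_of_countable _) hκ,
    lintegral_fintype]
  refine Finset.sum_congr rfl fun j _ => ?_
  rw [map_smul, enorm_smul, ENNReal.mul_rpow_of_nonneg _ _ hp.le, hd, mul_comm]

/-- The summing inequality for random vectors with a moment of order `p`. -/
theorem lintegral_le_of_isMultipleSummingConst [BorelSpace E] [SecondCountableTopology E]
    {ν : Measure E} [IsProbabilityMeasure ν]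
    {p : ℝ} (hp : 0 < p) {c : ℝ≥0∞} (hc : c ≠ ∞)
    (hν : ∀ γ : E →L[𝕜] 𝕜, ∫⁻ z, ‖γ z‖ₑ ^ p ∂ν ≤ c * ‖γ‖ₑ ^ p)
    (hint : ∫⁻ z, ‖z‖ₑ ^ p ∂ν ≠ ∞) {m : ℕ}
    (T : ContinuousMultilinearMap 𝕜 (fun _ : Fin m => E) X)
    {C : ℝ} (hC : 0 ≤ C) (hT : IsMultipleSummingConst p T C) :
    ∫⁻ z, ‖T z‖ₑ ^ p ∂(Measure.pi fun _ : Fin m => ν) ≤ ENNReal.ofReal C ^ p * c ^ m := by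
  -- With `0` placed first, the nearest point to `z` is never farther than `0`, so `‖z‖` dominates
  -- the approximation error.
  let e : ℕ → E := fun k => Nat.casesOn k 0 (TopologicalSpace.denseSeq E)
  have he : ∀ x, x ∈ closure (Set.range e) := fun x => by
    refine closure_mono ?_ (TopologicalSpace.denseRange_denseSeq E x)
    rintro _ ⟨k, rfl⟩
    exact ⟨k + 1, rfl⟩
  let φ : ℕ → E → E := fun n => SimpleFunc.nearestPt e n
  have hφm : ∀ n, Measurable (φ n) := fun n => SimpleFunc.measurable _
  have hφ : ∀ z, Tendsto (fun n => φ n z) atTop (𝓝 z) := fun z =>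
    SimpleFunc.tendsto_nearestPt (he z)
  have hφd : ∀ n z, ‖φ n z - z‖ₑ ≤ ‖z‖ₑ := fun n z => by
    have := SimpleFunc.edist_nearestPt_le e z (Nat.zero_le n)
    rw [edist_eq_enorm_sub, edist_eq_enorm_sub] at this
    simpa [e] using this
  let δ : ℕ → ℝ≥0∞ := fun n => ∫⁻ z, ‖φ n z - z‖ₑ ^ p ∂ν
  have hδ : Tendsto δ atTop (𝓝 0) := by
    have := tendsto_lintegral_of_dominated_convergence (μ := ν)
      (F := fun n z => ‖φ n z - z‖ₑ ^ p) (f := fun _ => 0) (fun z => ‖z‖ₑ ^ p)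
      (fun n => by have := hφm n; fun_prop)
      (fun n => ae_of_all _ fun z => ENNReal.rpow_le_rpow (hφd n z) hp.le) hint
      (ae_of_all _ fun z => ?_)
    · simpa using this
    · have h1 : Tendsto (fun n => ‖φ n z - z‖ₑ) atTop (𝓝 0) := by
        have := ((hφ z).sub_const z).enorm
        simpa using this
      have h2 := (ENNReal.continuous_rpow_const (y := p)).tendsto 0 |>.comp h1
      simpa [ENNReal.zero_rpow_of_pos hp, Function.comp_def] using h2
  have hb : ∀ η : ℝ≥0∞, η ≠ 0 → η ≠ ∞ → ∀ n,
      ∫⁻ z, ‖T fun i => φ n (z i)‖ₑ ^ p ∂(Measure.pi fun _ : Fin m => ν) ≤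
        ENNReal.ofReal C ^ p * ((1 + η) ^ p * c + (1 + η⁻¹) ^ p * δ n) ^ m := by
    intro η h0 ht n
    refine lintegral_le_of_isMultipleSummingConst_of_finite (J := n + 1) hp T hC hT
      (fun j => e j)
      (κ := fun z => ⟨SimpleFunc.nearestPtInd e n z,
        Nat.lt_succ_of_le (SimpleFunc.nearestPtInd_le e n z)⟩)
      (measurable_to_countable' fun j => ?_) fun γ hγ => ?_
    · convert (SimpleFunc.nearestPtInd e n).measurableSet_fiber j.1 using 1
      ext z
      simp [Fin.ext_iff]
    have hγ' : ‖γ‖ₑ ≤ 1 := by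
      rw [← ofReal_norm]
      exact ENNReal.ofReal_le_one.2 hγ
    calc ∫⁻ z, ‖γ (φ n z)‖ₑ ^ p ∂ν
        ≤ ∫⁻ z, ((1 + η) ^ p * ‖γ z‖ₑ ^ p + (1 + η⁻¹) ^ p * ‖φ n z - z‖ₑ ^ p) ∂ν := by
          refine lintegral_mono fun z => ?_
          refine le_trans (ENNReal.rpow_le_rpow ?_ hp.le)
            (ENNReal.add_rpow_le_mul_add_mul hp h0 ht _ _)
          calc ‖γ (φ n z)‖ₑ = ‖γ z + γ (φ n z - z)‖ₑ := by rw [← map_add]; simp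
            _ ≤ ‖γ z‖ₑ + ‖γ (φ n z - z)‖ₑ := enorm_add_le _ _
            _ ≤ _ := by
              gcongr
              exact (γ.le_opENorm _).trans (mul_le_of_le_one_left' hγ')
      _ = (1 + η) ^ p * ∫⁻ z, ‖γ z‖ₑ ^ p ∂ν + (1 + η⁻¹) ^ p * δ n := by
          rw [lintegral_add_left (by fun_prop), lintegral_const_mul _ (by fun_prop),
            lintegral_const_mul _ (by have := hφm n; fun_prop)]
      _ ≤ _ := by
          gcongr
          refine (hν γ).trans (mul_le_of_le_one_right' ?_)
          exact ENNReal.rpow_le_one hγ' hp.le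
  -- Fatou's lemma as `n → ∞` with `η` fixed; `η → 0` comes afterwards, since `1 + η⁻¹` has to stay
  -- finite while `δ n → 0`.
  have hfat : ∀ η : ℝ≥0∞, η ≠ 0 → η ≠ ∞ →
      ∫⁻ z, ‖T z‖ₑ ^ p ∂(Measure.pi fun _ : Fin m => ν) ≤
        ENNReal.ofReal C ^ p * ((1 + η) ^ p * c) ^ m := by
    intro η h0 ht
    have hTc : Continuous fun z => ‖T z‖ₑ ^ p :=
      ENNReal.continuous_rpow_const.comp T.cont.enorm
    have hlim : ∀ z : Fin m → E, Tendsto (fun n => ‖T fun i => φ n (z i)‖ₑ ^ p) atTop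
        (𝓝 (‖T z‖ₑ ^ p)) := fun z =>
      (hTc.tendsto z).comp (tendsto_pi_nhds.2 fun i => hφ (z i))
    have hη : (1 + η⁻¹) ^ p ≠ ∞ :=
      ENNReal.rpow_ne_top_of_nonneg hp.le (by simp [h0])
    have hlim2 : Tendsto (fun n => ENNReal.ofReal C ^ p *
        ((1 + η) ^ p * c + (1 + η⁻¹) ^ p * δ n) ^ m) atTop
        (𝓝 (ENNReal.ofReal C ^ p * ((1 + η) ^ p * c + (1 + η⁻¹) ^ p * 0) ^ m)) := by
      refine ENNReal.Tendsto.const_mul ?_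
        (Or.inr (ENNReal.rpow_ne_top_of_nonneg hp.le ENNReal.ofReal_ne_top))
      exact ((ENNReal.continuous_pow m).tendsto _).comp
        (tendsto_const_nhds.add (ENNReal.Tendsto.const_mul hδ (Or.inr hη)))
    rw [mul_zero, add_zero] at hlim2
    calc ∫⁻ z, ‖T z‖ₑ ^ p ∂(Measure.pi fun _ : Fin m => ν)
        = ∫⁻ z, liminf (fun n => ‖T fun i => φ n (z i)‖ₑ ^ p) atTop
            ∂(Measure.pi fun _ : Fin m => ν) :=
          lintegral_congr fun z => (hlim z).liminf_eq.symm
      _ ≤ liminf (fun n => ∫⁻ z, ‖T fun i => φ n (z i)‖ₑ ^ p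
            ∂(Measure.pi fun _ : Fin m => ν)) atTop :=
          lintegral_liminf_le fun n => hTc.measurable.comp
            (measurable_pi_lambda _ fun i => (hφm n).comp (measurable_pi_apply i))
      _ ≤ liminf (fun n => ENNReal.ofReal C ^ p *
            ((1 + η) ^ p * c + (1 + η⁻¹) ^ p * δ n) ^ m) atTop :=
          liminf_le_liminf (Eventually.of_forall (hb η h0 ht))
      _ = _ := hlim2.liminf_eq
  have hlim3 : Tendsto (fun η : ℝ≥0∞ => ENNReal.ofReal C ^ p * ((1 + η) ^ p * c) ^ m) (𝓝[>] 0)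
      (𝓝 (ENNReal.ofReal C ^ p * ((1 + 0) ^ p * c) ^ m)) := by
    refine tendsto_nhdsWithin_of_tendsto_nhds ?_
    refine ENNReal.Tendsto.const_mul ?_
      (Or.inr (ENNReal.rpow_ne_top_of_nonneg hp.le ENNReal.ofReal_ne_top))
    refine ((ENNReal.continuous_pow m).tendsto _).comp
      (ENNReal.Tendsto.mul_const ?_ (Or.inr hc))
    refine (ENNReal.continuous_rpow_const.comp (continuous_const.add continuous_id)).tendsto 0
  have := ge_of_tendsto hlim3 (by
    filter_upwards [eventually_mem_nhdsWithin,
      mem_nhdsWithin_of_mem_nhds (Iio_mem_nhds ENNReal.zero_lt_top)] with η h0 ht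
    exact hfat η (ne_of_gt h0) (ne_of_lt ht))
  simpa using this

end Discretization

/-! ### The summing norm as an integral -/

section Equality

variable {𝕜 : Type*} [RCLike 𝕜] {E : Type*} [NormedAddCommGroup E] [NormedSpace 𝕜 E]
  [MeasurableSpace E] [BorelSpace E] [SecondCountableTopology E]
  {X : Type*} [NormedAddCommGroup X] [NormedSpace 𝕜 X]

/-- The bound `‖T z‖ ≤ ‖T‖ ∏ ‖z i‖` gives a majorant that is a product of integrable functions of
separate variables. -/
theorem integrable_norm_rpow_multilinear {ν : Measure E} [IsProbabilityMeasure ν] {p : ℝ}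
    (hp : 0 < p) (hint : Integrable (fun z => ‖z‖ ^ p) ν) {m : ℕ}
    (T : ContinuousMultilinearMap 𝕜 (fun _ : Fin m => E) X) :
    Integrable (fun z => ‖T z‖ ^ p) (Measure.pi fun _ : Fin m => ν) := by
  have h1 : Integrable (fun z : Fin m → E => ‖T‖ ^ p * ∏ i, ‖z i‖ ^ p)
      (Measure.pi fun _ : Fin m => ν) :=
    (Integrable.fintype_prod (f := fun _ z => ‖z‖ ^ p) fun _ => hint).const_mul _
  have hc : Continuous fun z : Fin m → E => ‖T z‖ ^ p :=
    T.cont.norm.rpow_const fun _ => Or.inr hp.le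
  refine h1.mono' hc.aestronglyMeasurable (ae_of_all _ fun z => ?_)
  rw [Real.norm_of_nonneg (by positivity), Real.finsetProd_rpow _ _ fun i _ => norm_nonneg _,
    ← Real.mul_rpow (norm_nonneg _) (by positivity)]
  exact Real.rpow_le_rpow (norm_nonneg _) (T.le_opNorm z) hp.le

/-- If the dual norm of `E` is the `L_p`-norm of `ν`, up to the constant `c`, and `ℓ_q^n` embeds
into `L_p`, then the multiple summing norm of a map into an `ℒ^g_{q,1}`-space is an `L_p`-norm. -/
theorem multipleSummingNorm_eq_of_isLgSpace [FiniteDimensional 𝕜 E]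
    {ν : Measure E} [IsProbabilityMeasure ν] {p : ℝ} (hp : 0 < p) {c : ℝ≥0∞}
    (hc0 : c ≠ 0) (hc : c ≠ ∞)
    (hν : ∀ γ : E →L[𝕜] 𝕜, ∫⁻ z, ‖γ z‖ₑ ^ p ∂ν = c * ‖γ‖ₑ ^ p)
    (hint : Integrable (fun z => ‖z‖ ^ p) ν)
    {q : ℝ≥0∞} [Fact (1 ≤ q)]
    (hq : ∀ n : ℕ, ∃ ω : Measure (Fin n → 𝕜), SFinite ω ∧
      ∀ y : PiLp q (fun _ : Fin n => 𝕜), ∫⁻ w, ‖∑ i, y i * w i‖ₑ ^ p ∂ω = ‖y‖ₑ ^ p)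
    (hX : IsLgSpace 𝕜 q 1 X)
    {m : ℕ} (T : ContinuousMultilinearMap 𝕜 (fun _ : Fin m => E) X) :
    IsMultipleSumming p T ∧ multipleSummingNorm p T = 1 / (c.toReal ^ (1 / p)) ^ m *
      (∫ z, ‖T z‖ ^ p ∂(Measure.pi fun _ : Fin m => ν)) ^ (1 / p) := by
  have hintT := integrable_norm_rpow_multilinear hp hint T
  set I := ∫ z, ‖T z‖ ^ p ∂(Measure.pi fun _ : Fin m => ν) with hI
  have hI0 : 0 ≤ I := integral_nonneg fun z => by positivity
  have hIl : ∫⁻ z, ‖T z‖ₑ ^ p ∂(Measure.pi fun _ : Fin m => ν) = ENNReal.ofReal I := by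
    rw [ofReal_integral_eq_lintegral_ofReal hintT (ae_of_all _ fun z => by positivity)]
    exact lintegral_congr fun z => enorm_rpow_eq_ofReal hp.le _
  have hintl : ∫⁻ z, ‖z‖ₑ ^ p ∂ν ≠ ∞ := by
    have := hint.lintegral_lt_top.ne
    rwa [lintegral_congr fun z => (enorm_rpow_eq_ofReal hp.le z).symm] at this
  set D := 1 / (c.toReal ^ (1 / p)) ^ m * I ^ (1 / p) with hD
  have hcr : 0 < c.toReal := ENNReal.toReal_pos hc0 hc
  have hD0 : 0 ≤ D := by positivity
  -- `D` is the solution of `c ^ m D ^ p = I`, so `c ^ m` cancels in both estimates.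
  have hDp : c ^ m * ENNReal.ofReal D ^ p = ENNReal.ofReal I := by
    conv_lhs => rw [← ENNReal.ofReal_toReal hc]
    rw [← ENNReal.ofReal_pow hcr.le, ENNReal.ofReal_rpow_of_nonneg hD0 hp.le,
      ← ENNReal.ofReal_mul (by positivity)]
    congr 1
    rw [hD, Real.mul_rpow (by positivity) (by positivity), one_div p, Real.rpow_inv_rpow hI0 hp.ne',
      one_div, Real.inv_rpow (by positivity), ← Real.rpow_natCast (c.toReal ^ p⁻¹),
      ← Real.rpow_mul hcr.le, ← Real.rpow_mul hcr.le]
    have : p⁻¹ * (m : ℝ) * p = m := by field_simp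
    rw [this, Real.rpow_natCast, mul_inv_cancel_left₀ (by positivity)]
  have hadm : ∀ C, D ≤ C → IsMultipleSummingConst p T C := by
    intro C hC
    rw [isMultipleSummingConst_iff_enorm hp T (hD0.trans hC)]
    intro J x
    have h1 := sum_enorm_rpow_le_lintegral_of_isLgSpace hp hν hq hX T J x
      (fun i => ENNReal.ofReal (weakLpNorm 𝕜 p (x i)) ^ p)
      (fun i γ => sum_enorm_rpow_le_weakLpNorm hp (x i) γ)
    rw [hIl, ← hDp, mul_left_comm,
      ENNReal.mul_le_mul_iff_right (pow_ne_zero _ hc0) (ENNReal.pow_ne_top hc), mul_comm] at h1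
    refine h1.trans (mul_le_mul_left (ENNReal.rpow_le_rpow ?_ hp.le) _)
    exact ENNReal.ofReal_le_ofReal hC
  have hlow : ∀ C, 0 < C → IsMultipleSummingConst p T C → D ≤ C := by
    intro C hC hT
    have h1 := lintegral_le_of_isMultipleSummingConst hp hc (fun γ => (hν γ).le) hintl T hC.le hT
    rw [hIl, ← hDp, mul_comm (ENNReal.ofReal C ^ p),
      ENNReal.mul_le_mul_iff_right (pow_ne_zero _ hc0) (ENNReal.pow_ne_top hc),
      ENNReal.rpow_le_rpow_iff hp] at h1
    exact (ENNReal.ofReal_le_ofReal_iff hC.le).1 h1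
  refine ⟨⟨D + 1, by positivity, hadm _ (by linarith)⟩, le_antisymm ?_ ?_⟩
  -- `D` may be `0` while admissible constants must be positive, hence the approach through `D + ε`.
  · refine le_of_forall_pos_le_add fun ε hε => ?_
    exact csInf_le ⟨0, fun C hC => hC.1.le⟩ ⟨by positivity, hadm _ (by linarith)⟩
  · exact le_csInf ⟨D + 1, by positivity, hadm _ (by linarith)⟩ fun C hC => hlow C hC.1 hC.2

end Equality

/-! ### Embedding `ℓ_q^n` into `L_p` -/

section Representation

variable {𝕜 : Type*} [RCLike 𝕜] {p : ℝ} {q : ℝ≥0∞} [Fact (1 ≤ q)]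

/-- The embedding of `ℓ_q^n` into `L_p` by `q`-stable variables. -/
theorem exists_representation_of_stable (hp : 0 < p) (hq2 : q ≤ 2)
    (h : p < q.toReal ∨ q.toReal = 2) (n : ℕ) :
    ∃ ω : Measure (Fin n → 𝕜), SFinite ω ∧
      ∀ y : PiLp q (fun _ : Fin n => 𝕜), ∫⁻ w, ‖∑ i, y i * w i‖ₑ ^ p ∂ω = ‖y‖ₑ ^ p := by
  have hqt : q ≠ ∞ := ne_top_of_le_ne_top (by simp) hq2
  have hs2 : q.toReal ≤ 2 := by simpa using ENNReal.toReal_mono (by simp) hq2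
  have hs : 0 < q.toReal :=
    ENNReal.toReal_pos (zero_lt_one.trans_le (Fact.out : 1 ≤ q)).ne' hqt
  -- Dividing by the `p`-th moment makes the embedding isometric; `ω` need not be a probability
  -- measure.
  refine ⟨(∫⁻ z, ‖z‖ₑ ^ p ∂(stableMeasure 𝕜 q.toReal 1))⁻¹ • stableMeasurePi 𝕜 n q.toReal 1,
    by unfold stableMeasurePi; infer_instance, fun y => ?_⟩
  rw [lintegral_smul_measure, lintegral_sum_mul_stableMeasurePi hs hs2 one_pos hp, smul_eq_mul,
    ← mul_assoc, ENNReal.inv_mul_cancel (lintegral_stableMeasure_ne_zero hs hs2 one_pos hp)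
      (lintegral_stableMeasure_ne_top hs hs2 one_pos hp h), one_mul,
    ← PiLp.norm_eq_sum hs, ofReal_norm]

/-- The trivial embedding of `ℓ_p^n` into `L_p`. -/
theorem exists_representation_of_eq (hp : 0 < p) (h : ENNReal.ofReal p = q) (n : ℕ) :
    ∃ ω : Measure (Fin n → 𝕜), SFinite ω ∧
      ∀ y : PiLp q (fun _ : Fin n => 𝕜), ∫⁻ w, ‖∑ i, y i * w i‖ₑ ^ p ∂ω = ‖y‖ₑ ^ p := by
  -- Counting measure on the unit vectors: the integral is `∑ |y k| ^ p`.
  refine ⟨∑ k : Fin n, Measure.dirac (Pi.single k 1), inferInstance, fun y => ?_⟩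
  have hq : q.toReal = p := by rw [← h, ENNReal.toReal_ofReal hp.le]
  rw [lintegral_finsetSum_measure, enorm_rpow_eq_ofReal hp.le, PiLp.norm_eq_sum (by rwa [hq]), hq,
    one_div, Real.rpow_inv_rpow (by positivity) hp.ne', ← sum_enorm_rpow_eq_ofReal hp.le]
  refine Finset.sum_congr rfl fun k _ => ?_
  rw [lintegral_dirac]
  simp [Pi.single_apply]

end Representation

/-! ### The main theorem -/

theorem theorem1p2 {𝕜 : Type*} [RCLike 𝕜] {X : Type*} [NormedAddCommGroup X] [NormedSpace 𝕜 X]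
    (m N : ℕ) (p : ℝ) (hp : 0 < p)
    (q r r' : ℝ≥0∞) [Fact (1 ≤ q)] [Fact (1 ≤ r)] [ENNReal.HolderConjugate r r']
    (σ : ℝ) (hσ : 0 < σ)
    (hX : IsLgSpace 𝕜 q 1 X)
    (hpqr : (r = 2 ∧ q = 2) ∨
      (r = 2 ∧ ((ENNReal.ofReal p < q ∧ q < 2) ∨ ENNReal.ofReal p = q)) ∨
      (ENNReal.ofReal p < r' ∧ r' < 2 ∧
        ((ENNReal.ofReal p < q ∧ q ≤ 2) ∨ ENNReal.ofReal p = q)))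
    (T : ContinuousMultilinearMap 𝕜 (fun _ : Fin m => PiLp r (fun _ : Fin N => 𝕜)) X) :
    IsMultipleSumming p T ∧
    Integrable (fun z : Fin m → Fin N → 𝕜 => ‖T fun i => WithLp.toLp r (z i)‖ ^ p)
      (Measure.pi fun _ : Fin m => stableMeasurePi 𝕜 N r'.toReal σ) ∧
    multipleSummingNorm p T =
      1 / stableMoment 𝕜 r'.toReal σ p ^ m *
        (∫ z : Fin m → Fin N → 𝕜, ‖T fun i => WithLp.toLp r (z i)‖ ^ p
          ∂(Measure.pi fun _ : Fin m => stableMeasurePi 𝕜 N r'.toReal σ)) ^ (1 / p) := by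
  have htwo : r = 2 → r' = 2 := by
    rintro rfl
    have : ENNReal.HolderConjugate 2 2 := ⟨by simpa using ENNReal.inv_two_add_inv_two⟩
    exact ENNReal.HolderConjugate.unique 2 r' 2
  have hr' : r' ≤ 2 ∧ (p < r'.toReal ∨ r'.toReal = 2) := by
    rcases hpqr with ⟨h, -⟩ | ⟨h, -⟩ | ⟨h1, h2, -⟩
    · simp [htwo h]
    · simp [htwo h]
    · exact ⟨h2.le, Or.inl ((ENNReal.ofReal_lt_iff_lt_toReal hp.le h2.ne_top).1 h1)⟩
  have hq : ∀ n : ℕ, ∃ ω : Measure (Fin n → 𝕜), SFinite ω ∧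
      ∀ y : PiLp q (fun _ : Fin n => 𝕜), ∫⁻ w, ‖∑ i, y i * w i‖ₑ ^ p ∂ω = ‖y‖ₑ ^ p := by
    have hlt : ENNReal.ofReal p < q → q ≤ 2 → p < q.toReal := fun h1 h2 =>
      (ENNReal.ofReal_lt_iff_lt_toReal hp.le (ne_top_of_le_ne_top (by simp) h2)).1 h1
    rcases hpqr with ⟨-, h⟩ | ⟨-, ⟨h1, h2⟩ | h⟩ | ⟨-, -, ⟨h1, h2⟩ | h⟩
    · exact exists_representation_of_stable hp h.le (Or.inr (by simp [h]))
    · exact exists_representation_of_stable hp h2.le (Or.inl (hlt h1 h2.le))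
    · exact exists_representation_of_eq hp h
    · exact exists_representation_of_stable hp h2 (Or.inl (hlt h1 h2))
    · exact exists_representation_of_eq hp h
  have hrt : r' ≠ ∞ := ne_top_of_le_ne_top (by simp) hr'.1
  have hs2 : r'.toReal ≤ 2 := by simpa using ENNReal.toReal_mono (by simp) hr'.1
  have hs : 0 < r'.toReal := ENNReal.toReal_pos (ENNReal.HolderConjugate.ne_zero r' r) hrt
  have : IsProbabilityMeasure (stableMeasurePi 𝕜 N r'.toReal σ) := by
    unfold stableMeasurePi; infer_instance
  have hm : Measurable fun z : Fin N → 𝕜 => (WithLp.toLp r z : PiLp r (fun _ : Fin N => 𝕜)) :=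
    (PiLp.continuous_toLp r _).measurable
  -- The stable law is carried over to `ℓ_r^N`, where the general results apply; the integrals are
  -- pulled back at the end.
  set ν := (stableMeasurePi 𝕜 N r'.toReal σ).map
    (fun z => (WithLp.toLp r z : PiLp r (fun _ : Fin N => 𝕜))) with hν
  have hνp : IsProbabilityMeasure ν := Measure.isProbabilityMeasure_map hm.aemeasurable
  have hint : Integrable (fun z => ‖z‖ ^ p) ν := by
    have hc : Continuous fun z : PiLp r (fun _ : Fin N => 𝕜) => ‖z‖ ^ p :=
      continuous_norm.rpow_const fun _ => Or.inr hp.le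
    rw [hν, integrable_map_measure hc.aestronglyMeasurable hm.aemeasurable]
    have := (memLp_toLp_stableMeasurePi (𝕜 := 𝕜) hs hs2 hσ hp hr'.2 N r).integrable_norm_rpow
      (by simpa) (by simp)
    rwa [ENNReal.toReal_ofReal hp.le] at this
  have hdual : ∀ γ : PiLp r (fun _ : Fin N => 𝕜) →L[𝕜] 𝕜, ∫⁻ z, ‖γ z‖ₑ ^ p ∂ν =
      (∫⁻ z, ‖z‖ₑ ^ p ∂(stableMeasure 𝕜 r'.toReal σ)) * ‖γ‖ₑ ^ p := fun γ => by
    rw [hν, lintegral_map (by fun_prop) hm]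
    simp_rw [apply_toLp_eq_sum]
    rw [lintegral_sum_mul_stableMeasurePi hs hs2 hσ hp, ← opNorm_piLp_eq hrt, ofReal_norm]
  have hpi : (Measure.pi fun _ : Fin m => ν) =
      (Measure.pi fun _ : Fin m => stableMeasurePi 𝕜 N r'.toReal σ).map
        (fun z i => WithLp.toLp r (z i)) :=
    (Measure.pi_map_pi fun _ => hm.aemeasurable).symm
  have hm' : Measurable fun (z : Fin m → Fin N → 𝕜) (i : Fin m) =>
      (WithLp.toLp r (z i) : PiLp r (fun _ : Fin N => 𝕜)) :=
    measurable_pi_lambda _ fun i => hm.comp (measurable_pi_apply i)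
  have hTc : Continuous fun z => ‖T z‖ ^ p := T.cont.norm.rpow_const fun _ => Or.inr hp.le
  obtain ⟨h1, h2⟩ := multipleSummingNorm_eq_of_isLgSpace hp
    (lintegral_stableMeasure_ne_zero hs hs2 hσ hp)
    (lintegral_stableMeasure_ne_top hs hs2 hσ hp hr'.2) hdual hint hq hX T
  have h3 := integrable_norm_rpow_multilinear hp hint T
  rw [hpi, integrable_map_measure hTc.aestronglyMeasurable hm'.aemeasurable] at h3
  rw [hpi, integral_map hm'.aemeasurable hTc.aestronglyMeasurable] at h2
  have hmom : ∫ z, ‖z‖ ^ p ∂(stableMeasure 𝕜 r'.toReal σ) =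
      (∫⁻ z, ‖z‖ₑ ^ p ∂(stableMeasure 𝕜 r'.toReal σ)).toReal := by
    have hc : Continuous fun z : 𝕜 => ‖z‖ ^ p :=
      continuous_norm.rpow_const fun _ => Or.inr hp.le
    rw [integral_eq_lintegral_of_nonneg_ae (ae_of_all _ fun z => by positivity)
      hc.aestronglyMeasurable, lintegral_congr fun z : 𝕜 => enorm_rpow_eq_ofReal hp.le z]
  exact ⟨h1, h3, by rw [h2, stableMoment, hmom]⟩
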